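/- Let $p$ be an odd prime, $K=\mathbb{Q}(\zeta)$ the $p$-th cyclotomic field ($\zeta$ a primitive $p$-th root of unity), $O_K$ its ring of integers, $\pi=(1-\zeta)O_K$ the prime ideal over $p$, and $K^+=\mathbb{Q}(\zeta+\zeta^{-1})$. Let $u$ be a primitive root mod $p$, let $\sigma$ be the generator of $\mathrm{Gal}(K/\mathbb{Q})$ with $\sigma(\zeta)=\zeta^u$, and for $i\ge 0$ let $u_i$ be the integer with $u_i\equiv u^i \pmod p$, $1\le u_i\le p-1$. Let $C_p^+$ be the group of classes $c$ of the class group of $K^+$ with $c^p=1$, regarded as a subgroup of the class group of $K$ through extension of ideals. An integer $B\in O_K$ is *singular* if $B$ is not a $p$-th power in $K$ and $BO_K=\mathbf c^p$ for some ideal $\mathbf c$ of $O_K$. A singular integer $B$ is *positive* if moreover the class of $\mathbf c$ lies in $C_p^+$; it is *semi-primary* if $B\equiv c \pmod{\pi^2}$, and *primary* if $B\equiv c^p\pmod{\pi^p}$, for some $c\in\mathbb{Z}$ with $p\nmid c$. Let $\mathbf b$ be a nonzero ideal of $O_K$, not divisible by $\pi$, whose class $Cl(\mathbf b)$ lies in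 $C_p^+$ and is annihilated by $\sigma-\mu$ with $\mu\in\mathbf F_p^*$, that is, $Cl(\sigma(\mathbf b))=Cl(\mathbf b)^{\mu}$. Here and below an exponent $\mu$ denotes the representative of $\mu$ in $\{1,\dots,p-1\}$. If $\mathbf b$ is not principal, then $\mu=u_{2m}$ for some integer $m$ with $1\le m\le \frac{p-3}{2}$. Moreover, whether or not $\mathbf b$ is principal, for every integer $m$ with $1\le m\le\frac{p-3}{2}$ and $\mu=u_{2m}$: 1. There exist singular semi-primary positive integers $B\in O_K$ such that $BO_K=\mathbf b^p$ and $\sigma(B)=B^{\mu}\alpha^p$ for some $\alpha\in K$. 2. Every such $B$ that is not primary satisfies $\pi^{2m}\,\|\,B^{p-1}-1$, i.e. $B^{p-1}-1\in\pi^{2m}$ and $B^{p-1}-1\notin\pi^{2m+1}$. -/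

import Mathlib

open scoped NumberField nonZeroDivisors

noncomputable section

namespace Cyclo

/-- `u_i`: the residue of `u ^ i` modulo `p`, which lies in `{1, …, p - 1}` if `p ∤ u`. -/
def rootPow (p u i : ℕ) : ℕ := u ^ i % p

variable {K : Type*} [Field K]

/-- The prime ideal `π = (1 - ζ) O_K` of `O_K` lying over `p`. -/
def piIdeal {p : ℕ} [NeZero p] {ζ : K} (hζ : IsPrimitiveRoot ζ p) : Ideal (𝓞 K) :=
  Ideal.span {1 - hζ.toInteger}

/-- `π ^ n ‖ x`: the power `π ^ n` divides `x` exactly. -/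
def PiExactlyDivides {p : ℕ} [NeZero p] {ζ : K} (hζ : IsPrimitiveRoot ζ p) (n : ℕ) (x : 𝓞 K) :
    Prop :=
  x ∈ piIdeal hζ ^ n ∧ x ∉ piIdeal hζ ^ (n + 1)

/-- `B` is singular: `B` is not a `p`-th power in `K`, and the ideal `B O_K` is the `p`-th power of
an ideal of `O_K`. -/
def IsSingular (p : ℕ) (B : 𝓞 K) : Prop :=
  (¬ ∃ x : K, x ^ p = (B : K)) ∧ ∃ c : Ideal (𝓞 K), Ideal.span {B} = c ^ p

/-- A singular integer `B` is semi-primary if it is congruent modulo `π ^ 2` to a rational integer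
prime to `p`. -/
def IsSingularSemiPrimary {p : ℕ} [NeZero p] {ζ : K} (hζ : IsPrimitiveRoot ζ p) (B : 𝓞 K) :
    Prop :=
  IsSingular p B ∧ ∃ c : ℤ, ¬ (p : ℤ) ∣ c ∧ B - (c : 𝓞 K) ∈ piIdeal hζ ^ 2

/-- A singular integer `B` is primary if it is congruent modulo `π ^ p` to the `p`-th power of a
rational integer prime to `p`. -/
def IsSingularPrimary {p : ℕ} [NeZero p] {ζ : K} (hζ : IsPrimitiveRoot ζ p) (B : 𝓞 K) : Prop :=
  IsSingular p B ∧ ∃ c : ℤ, ¬ (p : ℤ) ∣ c ∧ B - (c : 𝓞 K) ^ p ∈ piIdeal hζ ^ p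

variable [NumberField K]

/-- The maximal totally real subfield `K⁺ = ℚ(ζ + ζ⁻¹)` of `K = ℚ(ζ)`. -/
abbrev realSubfield (ζ : K) : IntermediateField ℚ K :=
  IntermediateField.adjoin ℚ {ζ + ζ⁻¹}

/-- The group `C_p⁺`: the classes of exponent `p` of `K⁺`, seen in the class group of `K` through
extension of ideals. -/
def positiveClasses (p : ℕ) (ζ : K) : Subgroup (ClassGroup (𝓞 K)) :=
  (powMonoidHom p : ClassGroup (𝓞 (realSubfield ζ)) →* ClassGroup (𝓞 (realSubfield ζ))).ker.map
    (ClassGroup.extendedHom (𝓞 (realSubfield ζ)) (𝓞 K))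

/-- `B` is a positive singular integer: it is singular, and `B O_K = b ^ p` for an ideal `b` whose
class lies in `C_p⁺`. -/
def IsSingularPositive (p : ℕ) (ζ : K) (B : 𝓞 K) : Prop :=
  IsSingular p B ∧ ∃ b : (Ideal (𝓞 K))⁰,
    Ideal.span {B} = (b : Ideal (𝓞 K)) ^ p ∧ ClassGroup.mk0 b ∈ positiveClasses p ζ

/-- The conjugate ideal `σ(b)` of a nonzero ideal `b` of `O_K`. -/
def conjIdeal (σ : K ≃ₐ[ℚ] K) (b : (Ideal (𝓞 K))⁰) : (Ideal (𝓞 K))⁰ :=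
  ⟨(b : Ideal (𝓞 K)).map (NumberField.RingOfIntegers.mapRingEquiv σ.toRingEquiv), by
    rw [mem_nonZeroDivisors_iff_ne_zero]
    exact (Ideal.map_eq_bot_iff_of_injective (RingEquiv.injective _)).not.mpr
      (mem_nonZeroDivisors_iff_ne_zero.mp b.2)⟩

/-- The class of `b` is annihilated by `σ - μ`, i.e. `Cl(σ(b)) = Cl(b) ^ μ`; the element `μ` of
`𝔽_p` acts through its representative in `{0, …, p - 1}`. -/
def AnnihilatedBy {p : ℕ} (σ : K ≃ₐ[ℚ] K) (μ : ZMod p) (b : (Ideal (𝓞 K))⁰) : Prop :=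
  ClassGroup.mk0 (conjIdeal σ b) = ClassGroup.mk0 b ^ μ.val

end Cyclo

end

set_option linter.unusedSectionVars false

/-! Write `s = (p - 1) / 2` and `l = 1 - ζ`. Eigenvalue: `σ ^ s` is complex conjugation and fixes
classes coming from `K⁺`, so `μ ^ s = 1` when the class of `b` is nontrivial. The product of all
conjugates of `b` is principal, so `μ = 1` would give a class killed by both `p - 1` and `p`. Hence
`μ` is a nontrivial even power of `u`.

Exact power of `π`: if `l ^ n` exactly divides `B ^ (p - 1) - 1` with `n < p`, compare leading terms
in `σ(B) = B ^ μ α ^ p` raised to the power `p - 1`. There `σ` multiplies `l ^ n` by `u ^ n`, the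
exponent `μ` multiplies the term by `μ`, and `p`-th powers prime to `l` become `1` modulo `l ^ p`;
so `u ^ n = μ` (`dvd_pow_sub_of_exactly_dvd`). For `μ = u ^ (2m)` this forces `n = 2m`, while `n ≥
p` makes `B` primary. Excluding `n = 1` in the same way gives semi-primarity.

Existence: the exponents `μ ^ (-i)` on `σ ^ i` define a map `e` onto the `μ`-eigenspace modulo
`p`-th powers, acting there as `-1`. If `b` is not principal and `b ^ p = (B₀)`, then `e(b) b = (g)`
and `B = g ^ p / e(B₀)` works. If `b = (β)`, take `B = β ^ p e(η)` for a unit `η` such that `e(η)`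
is not a `p`-th power; `exists_unit_proj_ne_pow` finds it from Dirichlet's unit theorem and
Cayley–Hamilton. -/

namespace Cyclo

/-! ### Congruences modulo powers of a prime above `p` -/

section LocalCongruences

variable {R : Type*} [CommRing R] {p : ℕ} {l : R}

/-- Congruent elements modulo a divisor `l` of `p` have `p`-th powers congruent modulo `l ^ p`. -/
theorem pow_dvd_pow_sub_pow_of_dvd_sub (hp : p.Prime) (hpl : l ^ (p - 1) ∣ (p : R)) {x y : R}
    (h : l ∣ x - y) : l ^ p ∣ x ^ p - y ^ p := by
  obtain ⟨r, hr⟩ := exists_add_pow_prime_eq hp y (x - y)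
  rw [add_sub_cancel] at hr
  have h1 : l ^ p ∣ (x - y) ^ p := pow_dvd_pow_of_dvd h p
  have h2 : l ^ p ∣ (p : R) * (x - y) := by
    have := mul_dvd_mul hpl h
    rwa [← pow_succ, Nat.sub_add_cancel hp.one_le] at this
  have : x ^ p - y ^ p = (x - y) ^ p + (p : R) * (x - y) * (y * r) := by rw [hr]; ring
  rw [this]
  exact dvd_add h1 (h2.mul_right _)

/-- Fermat's little theorem modulo a prime `l` with residue ring generated by the integers. -/
theorem dvd_pow_sub_one_of_not_dvd (hp : p.Prime) (hpl : l ^ (p - 1) ∣ (p : R)) (hp2 : 2 ≤ p)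
    (hres : ∀ x : R, ∃ a : ℤ, l ∣ x - a) {x : R} (hx : ¬ l ∣ x) : l ∣ x ^ (p - 1) - 1 := by
  have hlp : l ∣ (p : R) := (dvd_pow_self l (by omega)).trans hpl
  obtain ⟨a, ha⟩ := hres x
  have hpa : ¬ (p : ℤ) ∣ a := by
    rintro ⟨c, rfl⟩
    apply hx
    have : l ∣ ((p * c : ℤ) : R) := by
      push_cast
      exact hlp.mul_right _
    simpa using dvd_add ha this
  have := Int.ModEq.pow_card_sub_one_eq_one hp
    (n := a) ((Int.isCoprime_iff_gcd_eq_one.mpr (by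
      rw [Int.gcd_comm]
      exact (Int.isCoprime_iff_gcd_eq_one.mp
        ((Nat.prime_iff_prime_int.mp hp).coprime_iff_not_dvd.mpr hpa)))))
  obtain ⟨c, hc⟩ := this.symm.dvd
  have hc' : (a : R) ^ (p - 1) - 1 = p * c := by exact_mod_cast congrArg (Int.cast (R := R)) hc
  have h1 : l ∣ x ^ (p - 1) - (a : R) ^ (p - 1) := ha.trans (sub_dvd_pow_sub_pow _ _ _)
  have : x ^ (p - 1) - 1 = (x ^ (p - 1) - (a : R) ^ (p - 1)) + p * c := by rw [← hc']; ring
  rw [this]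
  exact dvd_add h1 (hlp.mul_right _)

/-- Fermat holds modulo `l`, and a `p`-th power lifts it to `l ^ p`. This makes the factor `α ^ p`
invisible in the leading-term comparison. -/
theorem pow_dvd_pow_prime_sub_one_of_not_dvd (hp : p.Prime) (hpl : l ^ (p - 1) ∣ (p : R))
    (hp2 : 2 ≤ p) (hres : ∀ x : R, ∃ a : ℤ, l ∣ x - a) {x : R} (hx : ¬ l ∣ x) :
    l ^ p ∣ (x ^ p) ^ (p - 1) - 1 := by
  have := pow_dvd_pow_sub_pow_of_dvd_sub hp hpl (dvd_pow_sub_one_of_not_dvd hp hpl hp2 hres hx)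
  rwa [one_pow, pow_right_comm] at this

/-- If `τ B = B ^ k` up to `p`-th powers prime to `l`, where `τ l ≡ u l` modulo `l ^ 2`, and if
`l ^ n` exactly divides `B ^ (p - 1) - 1` with `1 ≤ n < p`, then `u ^ n ≡ k` modulo `p`. -/
theorem dvd_pow_sub_of_exactly_dvd [IsDomain R] (hl : Prime l) (hp : p.Prime) (hpl : l ^ (p - 1) ∣ (p : R))
    (hp2 : 2 ≤ p) (hres : ∀ x : R, ∃ a : ℤ, l ∣ x - a) (hint : ∀ a : ℤ, l ∣ (a : R) → (p : ℤ) ∣ a)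
    (τ : R →+* R) {u k n : ℕ} (hτ : l ^ 2 ∣ τ l - u * l) {B x y : R}
    (h : τ B * y ^ p = B ^ k * x ^ p) (hx : ¬ l ∣ x) (hy : ¬ l ∣ y) (hn : 1 ≤ n) (hnp : n < p)
    (hB : l ^ n ∣ B ^ (p - 1) - 1) (hB' : ¬ l ^ (n + 1) ∣ B ^ (p - 1) - 1) :
    (p : ℤ) ∣ (u : ℤ) ^ n - k := by
  have hX := (pow_dvd_pow l hnp).trans (pow_dvd_pow_prime_sub_one_of_not_dvd hp hpl hp2 hres hx)
  have hY := (pow_dvd_pow l hnp).trans (pow_dvd_pow_prime_sub_one_of_not_dvd hp hpl hp2 hres hy)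
  set A := B ^ (p - 1) with hA
  have h' : τ A * (y ^ p) ^ (p - 1) = A ^ k * (x ^ p) ^ (p - 1) := by
    rw [hA, map_pow, ← mul_pow, h, mul_pow, pow_right_comm]
  have hdiff : l ^ (n + 1) ∣ τ A - A ^ k := by
    have : τ A - A ^ k = A ^ k * ((x ^ p) ^ (p - 1) - 1) - τ A * ((y ^ p) ^ (p - 1) - 1) := by
      linear_combination h'
    rw [this]
    exact dvd_sub (hX.mul_left _) (hY.mul_left _)
  obtain ⟨t, ht⟩ := hB
  have hlt : ¬ l ∣ t := by
    rintro ⟨t', rfl⟩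
    exact hB' ⟨t', by rw [ht]; ring⟩
  obtain ⟨v, hv⟩ := hτ
  have hτl : τ l = l * (u + l * v) := by linear_combination hv
  -- `τ` is trivial on the residue ring, whose elements are represented by integers.
  have hτt : l ∣ τ t - t := by
    obtain ⟨a, t', ht'⟩ := hres t
    have : t = a + l * t' := by linear_combination ht'
    rw [this, map_add, map_intCast, map_mul, hτl]
    exact ⟨(u + l * v) * τ t' - t', by ring⟩
  have hA1 : A = l ^ n * t + 1 := by linear_combination ht
  obtain ⟨w, hw⟩ := sq_dvd_add_pow_sub_sub (l ^ n * t) 1 k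
  have hτA : τ A = l ^ n * ((u + l * v) ^ n * τ t) + 1 := by
    rw [hA1, map_add, map_one, map_mul, map_pow, hτl, mul_pow, mul_assoc]
  obtain ⟨c, hc⟩ := hdiff
  -- Comparing `τ A` with `A ^ k = 1 + k l ^ n t + …` and cancelling `l ^ n` leaves `u ^ n t ≡ k t`
  -- modulo `l`.
  have hcancel : (u + l * v) ^ n * τ t - k * t - l ^ n * (t ^ 2 * w) = l * c := by
    apply mul_left_cancel₀ (pow_ne_zero n hl.ne_zero)
    rw [hτA, hA1] at hc
    simp only [one_pow] at hw
    linear_combination hc + hw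
  have hun : l ∣ ((u : R) + l * v) ^ n - (u : R) ^ n :=
    (show l ∣ ((u : R) + l * v) - u from ⟨v, by ring⟩).trans (sub_dvd_pow_sub_pow _ _ _)
  have hfin : l ∣ (((u : ℤ) ^ n - k : ℤ) : R) * t := by
    obtain ⟨d, hd⟩ := hun
    obtain ⟨e, he⟩ := hτt
    obtain ⟨f, hf⟩ := dvd_pow_self l (show n ≠ 0 by omega)
    refine ⟨c + f * (t ^ 2 * w) - d * τ t - u ^ n * e, ?_⟩
    push_cast
    linear_combination hcancel - hd * τ t - u ^ n * he + hf * (t ^ 2 * w)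
  exact hint _ ((hl.dvd_or_dvd hfin).resolve_right hlt)

/-- If `B ^ (p - 1) ≡ 1` modulo `l ^ k` with `k ≤ p`, then `B` is congruent to the `p`-th power of
an integer prime to `p`. -/
theorem exists_int_pow_dvd_sub_pow (hp : p.Prime) (hpl : l ^ (p - 1) ∣ (p : R)) (hp2 : 2 ≤ p)
    (hres : ∀ x : R, ∃ a : ℤ, l ∣ x - a) {B : R} (hB : ¬ l ∣ B) {k : ℕ} (hk : k ≤ p)
    (h : l ^ k ∣ B ^ (p - 1) - 1) : ∃ c : ℤ, ¬ (p : ℤ) ∣ c ∧ l ^ k ∣ B - (c : R) ^ p := by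
  obtain ⟨c, hc⟩ := hres B
  refine ⟨c, ?_, ?_⟩
  · rintro ⟨d, rfl⟩
    apply hB
    have : l ∣ ((p * d : ℤ) : R) := by
      push_cast
      exact ((dvd_pow_self l (by omega)).trans hpl).mul_right _
    simpa using dvd_add hc this
  · have h1 := (pow_dvd_pow l hk).trans (pow_dvd_pow_sub_pow_of_dvd_sub hp hpl hc)
    have h2 : B * (B ^ (p - 1) - 1) = B ^ p - B := by
      rw [mul_sub, ← pow_succ', Nat.sub_add_cancel hp.one_le, mul_one]
    have h3 : B - (c : R) ^ p = (B ^ p - (c : R) ^ p) - B * (B ^ (p - 1) - 1) := by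
      rw [h2]; ring
    rw [h3]
    exact dvd_sub h1 (h.mul_left _)

end LocalCongruences

/-! ### Norms of ideals are principal -/

section IdealNorm

variable {R : Type*} [CommRing R] [IsDedekindDomain R]

/-- The product of the first `n` conjugates of an ideal under a ring automorphism. -/
noncomputable def conjProd (τ : R ≃+* R) (n : ℕ) : Ideal R →* Ideal R where
  toFun I := ∏ k ∈ Finset.range n, I.map ((τ ^ k : R ≃+* R) : R →+* R)
  map_one' := by simp [Ideal.one_eq_top, Ideal.map_top]
  map_mul' I J := by simp [Ideal.map_mul, Finset.prod_mul_distrib]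

theorem conjProd_apply (τ : R ≃+* R) (n : ℕ) (I : Ideal R) :
    conjProd τ n I = ∏ k ∈ Finset.range n, I.map ((τ ^ k : R ≃+* R) : R →+* R) := rfl

theorem map_map_pow (τ : R ≃+* R) (k : ℕ) (I : Ideal R) :
    (I.map ((τ ^ k : R ≃+* R) : R →+* R)).map (τ : R →+* R) =
      I.map ((τ ^ (k + 1) : R ≃+* R) : R →+* R) := by
  rw [Ideal.map_map, pow_succ']
  rfl

theorem conjProd_span_singleton (τ : R ≃+* R) (n : ℕ) (x : R) :
    conjProd τ n (Ideal.span {x}) = Ideal.span {∏ k ∈ Finset.range n, (τ ^ k) x} := by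
  simp [conjProd_apply, Ideal.map_span, Ideal.prod_span_singleton]

theorem conjProd_ne_bot (τ : R ≃+* R) (n : ℕ) {I : Ideal R} (hI : I ≠ ⊥) :
    conjProd τ n I ≠ ⊥ := by
  rw [conjProd_apply, ← Ideal.zero_eq_bot, Finset.prod_ne_zero_iff]
  intro k _
  rw [Ideal.zero_eq_bot]
  exact (Ideal.map_eq_bot_iff_of_injective (RingEquiv.injective _)).not.mpr hI

theorem map_conjProd (τ : R ≃+* R) (n : ℕ) (hτ : τ ^ n = 1) {I : Ideal R} (hI : I ≠ ⊥) :
    (conjProd τ n I).map (τ : R →+* R) = conjProd τ n I := by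
  have h : (conjProd τ n I).map (τ : R →+* R) =
      ∏ k ∈ Finset.range n, I.map ((τ ^ (k + 1) : R ≃+* R) : R →+* R) := by
    rw [conjProd_apply, ← Ideal.mapHom_apply, map_prod]
    exact Finset.prod_congr rfl fun k _ ↦ map_map_pow τ k I
  have h0 : I.map ((τ ^ 0 : R ≃+* R) : R →+* R) = I := by
    rw [pow_zero]
    exact Ideal.map_id I
  -- Applying `τ` permutes the factors cyclically; multiplying by `I` turns this into two ways of
  -- splitting a product of `n + 1` factors.
  apply mul_right_cancel₀ (show I ≠ 0 from hI)
  rw [h]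
  have h1 := (Finset.prod_range_succ' (fun k ↦ I.map ((τ ^ k : R ≃+* R) : R →+* R)) n).symm.trans
    (Finset.prod_range_succ _ n)
  rwa [hτ, ← pow_zero τ, h0, ← conjProd_apply] at h1

/-- If the products of conjugates of elements are rational integers, then the products of conjugates
of ideals are principal. -/
theorem conjProd_isPrincipal (τ : R ≃+* R) (n : ℕ) (hτ : τ ^ n = 1)
    (hN : ∀ x : R, ∃ z : ℤ, ∏ k ∈ Finset.range n, (τ ^ k) x = z) (I : Ideal R) :
    (conjProd τ n I).IsPrincipal := by
  by_cases hI : I = ⊥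
  · subst hI
    rw [← Ideal.span_singleton_zero, conjProd_span_singleton]
    exact ⟨_, rfl⟩
  obtain ⟨x, hxI, hx0⟩ := Submodule.exists_mem_ne_zero_of_ne_bot hI
  obtain ⟨J, hJ⟩ := Ideal.dvd_iff_le.mpr ((Ideal.span_singleton_le_iff_mem I).mpr hxI)
  have hJ0 : J ≠ ⊥ := by
    rintro rfl
    rw [Ideal.mul_bot, Ideal.span_singleton_eq_bot] at hJ
    exact hx0 hJ
  have hA0 := conjProd_ne_bot τ n hJ0
  set A := conjProd τ n J with hA
  -- With `(x) = I J` and `A` the norm of `J`, choose `(y) = I L` with `L` prime to `A`. As `A` is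
  -- stable under `τ`, the norm of `L` is prime to `A` too, so the norm of `I` is generated by the
  -- integers `N(x)` and `N(y)`, hence by their gcd.
  obtain ⟨y, hy⟩ := IsDedekindDomain.exists_sup_span_eq (I := I * A) (J := I) Ideal.mul_le_left
    (mul_ne_zero hI hA0)
  have hyI : Ideal.span {y} ≤ I := hy ▸ le_sup_right
  obtain ⟨L, hL⟩ := Ideal.dvd_iff_le.mpr hyI
  have hAL : A ⊔ L = ⊤ := by
    rw [hL, ← Ideal.mul_sup] at hy
    exact mul_left_cancel₀ hI (hy.trans (Ideal.mul_top I).symm)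
  have hAfix : ∀ k : ℕ, A.map ((τ ^ k : R ≃+* R) : R →+* R) = A := by
    intro k
    induction k with
    | zero => rw [pow_zero]; exact Ideal.map_id A
    | succ k ih => rw [← map_map_pow, ih, hA, map_conjProd τ n hτ hJ0]
  have hcop : A ⊔ conjProd τ n L = ⊤ := by
    rw [conjProd_apply]
    apply Ideal.sup_prod_eq_top
    intro k _
    have := congrArg (Ideal.map ((τ ^ k : R ≃+* R) : R →+* R)) hAL
    rwa [Ideal.map_sup, hAfix, Ideal.map_top] at this
  obtain ⟨a, ha⟩ := hN x
  obtain ⟨c, hc⟩ := hN y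
  have h1 : conjProd τ n I * A = Ideal.span {(a : R)} := by
    rw [hA, ← map_mul, ← hJ, conjProd_span_singleton, ha]
  have h2 : conjProd τ n I * conjProd τ n L = Ideal.span {(c : R)} := by
    rw [← map_mul, ← hL, conjProd_span_singleton, hc]
  have h3 : conjProd τ n I = Ideal.span {(a : R)} ⊔ Ideal.span {(c : R)} := by
    rw [← h1, ← h2, ← Ideal.mul_sup, hcop, Ideal.mul_top]
  obtain ⟨d, hd⟩ := (IsPrincipalIdealRing.principal (Ideal.span {a, c} : Ideal ℤ))
  refine ⟨(d : R), ?_⟩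
  have := congrArg (Ideal.map (Int.castRingHom R)) hd
  rw [Ideal.submodule_span_eq, Ideal.map_span, Ideal.map_span] at this
  rw [h3, ← Ideal.span_union, Ideal.submodule_span_eq]
  simpa [Set.image_pair, Set.pair_comm] using this

end IdealNorm

/-! ### The Galois action on `ℚ(ζ)` and its integers -/

section Galois

variable {p : ℕ} [Fact p.Prime] {K : Type*} [Field K] [NumberField K]
    {ζ : K} (hζ : IsPrimitiveRoot ζ p)
open IsCyclotomicExtension.Rat

include hζ in
theorem one_sub_pow_dvd_prime : (1 - hζ.toInteger) ^ (p - 1) ∣ (p : 𝓞 K) := by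
  have h : Associated (1 - hζ.toInteger) (hζ.toInteger - 1) := by
    rw [← neg_sub]; exact Associated.neg_left (Associated.refl _)
  exact ((h.pow_pow (n := p - 1)).trans (associated_zeta_sub_one_pow_prime p hζ)).dvd

variable [IsCyclotomicExtension {p} ℚ K]

theorem one_sub_prime : Prime (1 - hζ.toInteger) := by
  rw [← neg_sub]; exact hζ.zeta_sub_one_prime'.neg

theorem dvd_intCast_of_one_sub_dvd (a : ℤ) (h : 1 - hζ.toInteger ∣ (a : 𝓞 K)) : (p : ℤ) ∣ a := by
  rw [← neg_sub, neg_dvd] at h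
  exact (zeta_sub_one_dvd_intCast_iff' p hζ).mp h

/-- Since `O_K = ℤ[ζ]`, write `x = f(ζ)`; then `f(1)` is the required integer because `ζ ≡ 1`. -/
theorem exists_int_one_sub_dvd_sub (x : 𝓞 K) : ∃ a : ℤ, 1 - hζ.toInteger ∣ x - a := by
  have hadj : (algebraMap (𝓞 K) K x) ∈ Algebra.adjoin ℤ {ζ} := by
    have := (isIntegralClosure_adjoin_singleton_of_prime (p := p) hζ)
    obtain ⟨y, hy⟩ := (this.isIntegral_iff (x := algebraMap (𝓞 K) K x)).mp x.2
    rw [← hy]; exact y.2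
  rw [Algebra.adjoin_singleton_eq_range_aeval] at hadj
  obtain ⟨f, hf⟩ := hadj
  refine ⟨f.eval 1, ?_⟩
  have hx : x = Polynomial.aeval hζ.toInteger f := by
    apply NumberField.RingOfIntegers.ext
    rw [NumberField.RingOfIntegers.coe_eq_algebraMap, NumberField.RingOfIntegers.coe_eq_algebraMap,
      ← hf, ← Polynomial.aeval_algebraMap_apply]
    rfl
  rw [hx]
  have := Polynomial.sub_dvd_eval_sub (1 : 𝓞 K) hζ.toInteger (f.map (Int.castRingHom _))
  rw [← dvd_neg]
  convert this using 1
  simp [Polynomial.aeval_def, Polynomial.eval₂_eq_eval_map]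

variable {u : ℕ} (hu : IsPrimitiveRoot (u : ZMod p) (p - 1)) {σ : K ≃ₐ[ℚ] K} (hσ : σ ζ = ζ ^ u)

include hσ in
theorem pow_apply_zeta (k : ℕ) : (σ ^ k) ζ = ζ ^ u ^ k := by
  induction k with
  | zero => simp
  | succ k ih => rw [pow_succ', AlgEquiv.mul_apply, ih, map_pow, hσ, ← pow_mul, pow_succ']

include hζ in
theorem algEquiv_ext {σ τ : K ≃ₐ[ℚ] K} (h : σ ζ = τ ζ) : σ = τ := by
  have := (hζ.powerBasis ℚ).algHom_ext (f := (σ : K →ₐ[ℚ] K)) (g := (τ : K →ₐ[ℚ] K))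
    (by simpa using h)
  ext x
  exact DFunLike.congr_fun this x

include hζ in
theorem zeta_pow_eq_iff (i j : ℕ) : ζ ^ i = ζ ^ j ↔ (i : ZMod p) = j := by
  rw [ZMod.natCast_eq_natCast_iff, hζ.eq_orderOf,
    (hζ.isOfFinOrder (NeZero.ne p)).pow_eq_pow_iff_modEq]

include hζ hσ in
theorem pow_eq_pow_iff (i j : ℕ) : σ ^ i = σ ^ j ↔ (u : ZMod p) ^ i = (u : ZMod p) ^ j := by
  rw [← Nat.cast_pow, ← Nat.cast_pow, ← zeta_pow_eq_iff hζ, ← pow_apply_zeta hσ,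
    ← pow_apply_zeta hσ]
  exact ⟨fun h ↦ by rw [h], algEquiv_ext hζ⟩

include hζ hσ hu in
theorem pow_prime_sub_one_eq_one : σ ^ (p - 1) = 1 := by
  have := (pow_eq_pow_iff hζ hσ (p - 1) 0).mpr (by rw [hu.pow_eq_one, pow_zero])
  simpa using this

include hζ hσ hu in
theorem prod_range_pow_apply (x : K) :
    ∏ k ∈ Finset.range (p - 1), (σ ^ k) x = algebraMap ℚ K (Algebra.norm ℚ x) := by
  have := IsCyclotomicExtension.isGalois (S := {p}) (K := ℚ) (L := K)
  rw [Algebra.norm_eq_prod_automorphisms, ← Fin.prod_univ_eq_prod_range (fun k ↦ (σ ^ k) x)]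
  have hinj : Function.Injective (fun k : Fin (p - 1) ↦ σ ^ (k : ℕ)) := by
    intro i j hij
    have := (pow_eq_pow_iff hζ hσ i j).mp hij
    exact Fin.ext (hu.pow_inj i.2 j.2 this)
  have hcard : Fintype.card (Fin (p - 1)) = Fintype.card (K ≃ₐ[ℚ] K) := by
    rw [Fintype.card_fin, ← Nat.card_eq_fintype_card, IsGalois.card_aut_eq_finrank,
      IsCyclotomicExtension.Rat.finrank p K, Nat.totient_prime Fact.out]
  exact Fintype.prod_bijective _ ((Fintype.bijective_iff_injective_and_card _).mpr ⟨hinj, hcard⟩)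
    _ _ (fun _ ↦ rfl)

/-- The automorphism of the ring of integers induced by an automorphism of the field. -/
noncomputable abbrev intAut (σ : K ≃ₐ[ℚ] K) : 𝓞 K ≃+* 𝓞 K :=
  NumberField.RingOfIntegers.mapRingEquiv σ.toRingEquiv

theorem coe_intAut (σ : K ≃ₐ[ℚ] K) (x : 𝓞 K) : ((intAut σ x : 𝓞 K) : K) = σ x := rfl

theorem coe_intAut_pow (σ : K ≃ₐ[ℚ] K) (k : ℕ) (x : 𝓞 K) :
    (((intAut σ ^ k) x : 𝓞 K) : K) = (σ ^ k) x := by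
  induction k generalizing x with
  | zero => rfl
  | succ k ih => rw [pow_succ, pow_succ]; exact ih _

theorem intAut_pow (σ : K ≃ₐ[ℚ] K) (k : ℕ) : intAut σ ^ k = intAut (σ ^ k) := by
  ext x
  exact coe_intAut_pow σ k x

include hζ hσ hu in
theorem prod_range_intAut_pow (x : 𝓞 K) :
    ∏ k ∈ Finset.range (p - 1), (intAut σ ^ k) x = ((Algebra.norm ℤ x : ℤ) : 𝓞 K) := by
  apply NumberField.RingOfIntegers.ext
  rw [NumberField.RingOfIntegers.coe_eq_algebraMap, map_prod]
  simp only [← NumberField.RingOfIntegers.coe_eq_algebraMap, coe_intAut_pow, prod_range_pow_apply hζ hu hσ]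
  rw [← Algebra.coe_norm_int]
  simp

include hζ hσ hu in
/-- The product of all the conjugates of an ideal is principal. -/
theorem prod_conj_isPrincipal (I : Ideal (𝓞 K)) : (conjProd (intAut σ) (p - 1) I).IsPrincipal :=
  conjProd_isPrincipal _ _ (by
    rw [intAut_pow, pow_prime_sub_one_eq_one hζ hu hσ]; rfl) (fun x ↦ ⟨_, prod_range_intAut_pow hζ hu hσ x⟩) I

end Galois

/-! ### Eigenspace projectors modulo `p` -/

section Projector

open Polynomial

/-- If a cyclic convolution of an integer sequence with a periodic real sequence of zero sum, all of
whose terms but one are negative, vanishes, then the integer sequence is constant. -/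
theorem eq_of_cyclic_sum_eq_zero {s : ℕ} (a : ℕ → ℝ) (hper : ∀ k, a (k + s) = a k)
    (hneg : ∀ k, 0 < k → k < s → a k < 0) (hsum : ∑ k ∈ Finset.range s, a k = 0) (f : ℕ → ℤ)
    (h : ∀ i, ∑ k ∈ Finset.range s, (f k : ℝ) * a (i + k) = 0) {i j : ℕ} (hi : i < s) (hj : j < s) :
    f i = f j := by
  have hsum' : ∀ i, ∑ k ∈ Finset.range s, a (i + k) = 0 := by
    intro i
    induction i with
    | zero => simpa using hsum
    | succ i ih =>
      have h1 := (Finset.sum_range_succ' (fun k ↦ a (i + k)) s).symm.trans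
        (Finset.sum_range_succ (fun k ↦ a (i + k)) s)
      rw [ih, hper, add_zero, zero_add] at h1
      have h2 : ∑ k ∈ Finset.range s, a (i + (k + 1)) = 0 := by linarith
      rw [← h2]
      exact Finset.sum_congr rfl fun k _ ↦ by ring_nf
  -- Minimum principle: at the shift `s - m`, every coefficient with index other than `m` is
  -- negative. Subtracting `f m` from `f` then gives a vanishing sum of nonpositive terms.
  obtain ⟨m, hm, hmin⟩ := Finset.exists_min_image (Finset.range s) f ⟨i, Finset.mem_range.mpr hi⟩
  rw [Finset.mem_range] at hm
  have hlt : ∀ k, k < s → k ≠ m → a (s - m + k) < 0 := by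
    intro k hk hkm
    rcases lt_or_gt_of_ne hkm with hlt | hgt
    · exact hneg _ (by omega) (by omega)
    · rw [show s - m + k = (k - m) + s by omega, hper]
      exact hneg _ (by omega) (by omega)
  have hzero : ∑ k ∈ Finset.range s, ((f k : ℝ) - f m) * a (s - m + k) = 0 := by
    simp only [sub_mul, Finset.sum_sub_distrib, h, ← Finset.mul_sum, hsum', mul_zero, sub_zero]
  have hle : ∀ k ∈ Finset.range s, ((f k : ℝ) - f m) * a (s - m + k) ≤ 0 := by
    intro k hk
    by_cases hkm : k = m
    · simp [hkm]
    · exact mul_nonpos_of_nonneg_of_nonpos (sub_nonneg.mpr (by exact_mod_cast hmin k hk))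
        (hlt k (Finset.mem_range.mp hk) hkm).le
  have hall : ∀ k, k < s → f k = f m := by
    intro k hk
    by_cases hkm : k = m
    · rw [hkm]
    · have := (Finset.sum_eq_zero_iff_of_nonpos hle).mp hzero k (Finset.mem_range.mpr hk)
      rcases mul_eq_zero.mp this with h0 | h0
      · exact_mod_cast sub_eq_zero.mp h0
      · exact absurd h0 (hlt k hk hkm).ne
  rw [hall i hi, hall j hj]

variable {M : Type*} [AddCommGroup M]

/-- Because `l` is invariant under `T ^ s`, only the remainder `G` of `F` modulo `X ^ s - 1` matters
under `l`. The sign pattern of the values at `η` makes the coefficients of `G` all equal, so `F(μ) =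
G(μ)` is a multiple of `∑ μ ^ k = 0`. -/
theorem aeval_eq_zero_of_aeval_apply_eq_zero {s : ℕ} (hs : 0 < s) (T : Module.End ℤ M)
    (l : M →+ ℝ) (hl : ∀ x, l ((T ^ s) x) = l x) (η : M)
    (hneg : ∀ k, 0 < k → k < s → l ((T ^ k) η) < 0)
    (hsum : ∑ k ∈ Finset.range s, l ((T ^ k) η) = 0) {F : ℤ[X]} (hF : aeval T F η = 0)
    {S : Type*} [CommRing S] {μ : S} (hμ : ∑ k ∈ Finset.range s, μ ^ k = 0) : aeval μ F = 0 := by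
  have hmonic : (X ^ s - 1 : ℤ[X]).Monic := by simpa using monic_X_pow_sub_C (1 : ℤ) hs.ne'
  set G := F %ₘ (X ^ s - 1) with hG
  set Q := F /ₘ (X ^ s - 1) with hQ
  have hFG : F = G + (X ^ s - 1) * Q := (modByMonic_add_div F _).symm
  have hdeg : G.natDegree < s := by
    have h1 : (X ^ s - 1 : ℤ[X]).natDegree = s := by simpa using natDegree_X_pow_sub_C (r := (1 : ℤ))
    have := natDegree_modByMonic_lt F hmonic (by
      intro h
      rw [h, natDegree_one] at h1
      omega)
    rwa [h1] at this
  have key : ∀ i, ∑ k ∈ Finset.range s, (G.coeff k : ℝ) * l ((T ^ (i + k)) η) = 0 := by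
    intro i
    have h1 : aeval T (X ^ i * G) η = - aeval T ((X ^ s - 1) * (X ^ i * Q)) η := by
      rw [eq_neg_iff_add_eq_zero, ← LinearMap.add_apply, ← map_add,
        show X ^ i * G + (X ^ s - 1) * (X ^ i * Q) = X ^ i * F by rw [hFG]; ring, map_mul,
        Module.End.mul_apply, hF, map_zero]
    have h2 : l (aeval T (X ^ i * G) η) = 0 := by
      rw [h1, map_neg, map_mul, Module.End.mul_apply]
      simp [hl]
    have h3 : aeval T (X ^ i * G) η = ∑ k ∈ Finset.range s, G.coeff k • (T ^ (i + k)) η := by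
      rw [map_mul, aeval_eq_sum_range' hdeg, Finset.mul_sum, LinearMap.sum_apply]
      refine Finset.sum_congr rfl fun k _ ↦ ?_
      rw [map_pow, aeval_X, mul_smul_comm, ← pow_add, LinearMap.smul_apply]
    rw [h3, map_sum] at h2
    simpa using h2
  have hμs : μ ^ s = 1 := by
    have := geom_sum_mul μ s
    rw [hμ, zero_mul] at this
    exact (sub_eq_zero.mp this.symm)
  have hconst : ∀ k ∈ Finset.range s, G.coeff k = G.coeff 0 := fun k hk ↦
    eq_of_cyclic_sum_eq_zero (fun k ↦ l ((T ^ k) η))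
      (fun k ↦ by rw [add_comm, pow_add, Module.End.mul_apply, hl]) hneg hsum G.coeff key
      (Finset.mem_range.mp hk) hs
  rw [hFG, map_add, map_mul, map_sub, map_pow, aeval_X, map_one, hμs, sub_self, zero_mul, add_zero,
    aeval_eq_sum_range' hdeg, Finset.sum_congr rfl fun k hk ↦ by rw [hconst k hk],
    ← Finset.smul_sum, hμ, smul_zero]

/-- If `e(T)` mapped `M` into `pM`, Cayley–Hamilton would give a monic `P ≡ X ^ N` modulo `p` with
`P(e(T)) = 0`. The previous lemma applied to `P ∘ e` then yields `e(μ) ^ N = 0` in `𝔽_p`. No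
freeness of `M` is needed. -/
theorem exists_aeval_apply_ne_smul [Module.Finite ℤ M] {p : ℕ} [Fact p.Prime] {s : ℕ} (hs : 0 < s)
    (T : Module.End ℤ M) (l : M →+ ℝ) (hl : ∀ x, l ((T ^ s) x) = l x) (η : M)
    (hneg : ∀ k, 0 < k → k < s → l ((T ^ k) η) < 0)
    (hsum : ∑ k ∈ Finset.range s, l ((T ^ k) η) = 0) (e : ℤ[X]) {μ : ZMod p}
    (hμ : ∑ k ∈ Finset.range s, μ ^ k = 0) (he : aeval μ e ≠ 0) :
    ∃ x : M, ∀ y : M, aeval T e x ≠ (p : ℤ) • y := by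
  by_contra! hcon
  obtain ⟨P, hP, -, hcoeff, hPe⟩ :=
    LinearMap.exists_monic_and_natDegree_eq_and_coeff_mem_pow_and_aeval_eq_zero ℤ (aeval T e)
      (Ideal.span {(p : ℤ)}) (by
        rintro _ ⟨x, rfl⟩
        obtain ⟨y, hy⟩ := hcon x
        rw [hy]
        exact Submodule.smul_mem_smul (Ideal.mem_span_singleton_self _) trivial)
  have hF : aeval T (P.comp e) η = 0 := by rw [aeval_comp, hPe, LinearMap.zero_apply]
  have hzero := aeval_eq_zero_of_aeval_apply_eq_zero hs T l hl η hneg hsum hF hμ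
  rw [aeval_comp] at hzero
  have hPX : P.map (Int.castRingHom (ZMod p)) = X ^ P.natDegree := by
    ext k
    rw [coeff_map, coeff_X_pow]
    split_ifs with hk
    · rw [hk, hP.coeff_natDegree, map_one]
    · rcases lt_or_gt_of_ne hk with h | h
      · have h1 := Ideal.pow_le_self (show P.natDegree - k ≠ 0 by omega) (hcoeff k)
        rw [Ideal.mem_span_singleton] at h1
        simpa using (ZMod.intCast_zmod_eq_zero_iff_dvd _ p).mpr h1
      · rw [coeff_eq_zero_of_natDegree_lt h, map_zero]
  rw [aeval_def, ← eval_map, algebraMap_int_eq, hPX, eval_pow, eval_X] at hzero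
  exact pow_ne_zero _ he hzero

/-- The exponents of the projector to the eigenspace of eigenvalue `μ`. -/
def projExp {p : ℕ} (μ : (ZMod p)ˣ) (i : ℕ) : ℕ := ((μ⁻¹ ^ i : (ZMod p)ˣ) : ZMod p).val

theorem cast_projExp {p : ℕ} [NeZero p] (μ : (ZMod p)ˣ) (i : ℕ) :
    (projExp μ i : ZMod p) = ((μ⁻¹ ^ i : (ZMod p)ˣ) : ZMod p) := by
  rw [projExp, ZMod.natCast_zmod_val]

theorem projExp_prime_sub_one {p : ℕ} [Fact p.Prime] (μ : (ZMod p)ˣ) :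
    projExp μ (p - 1) = projExp μ 0 := by
  rw [projExp, projExp, ZMod.units_pow_card_sub_one_eq_one, pow_zero]

theorem sum_projExp_mul_pow {p : ℕ} [Fact p.Prime] (μ : (ZMod p)ˣ) :
    ∑ i ∈ Finset.range (p - 1), (projExp μ i : ZMod p) * (μ : ZMod p) ^ i = -1 := by
  have hp := (Fact.out : p.Prime).one_le
  have : ∀ i ∈ Finset.range (p - 1), (projExp μ i : ZMod p) * (μ : ZMod p) ^ i = 1 := by
    intro i _
    rw [cast_projExp, ← Units.val_pow_eq_pow_val, ← Units.val_mul, ← mul_pow, inv_mul_cancel,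
      one_pow, Units.val_one]
  rw [Finset.sum_congr rfl this, Finset.sum_const, Finset.card_range, nsmul_eq_mul, mul_one,
    Nat.cast_sub hp, ZMod.natCast_self, Nat.cast_one, zero_sub]

/-- The image of the projector is an eigenspace, up to `p`-th powers. -/
theorem exists_map_prod_pow_projExp_eq {A : Type*} [CommGroup A] {p : ℕ} [Fact p.Prime]
    (μ : (ZMod p)ˣ) (T : A →* A) (f : ℕ → A) (hf : ∀ i, T (f i) = f (i + 1))
    (hfp : f (p - 1) = f 0) :
    ∃ y : A, T (∏ i ∈ Finset.range (p - 1), f i ^ projExp μ i) =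
      (∏ i ∈ Finset.range (p - 1), f i ^ projExp μ i) ^ (μ : ZMod p).val * y ^ p := by
  have hz : ∀ i, ∃ z : ℤ, (projExp μ i : ℤ) = (μ : ZMod p).val * projExp μ (i + 1) + p * z := by
    intro i
    have : ((projExp μ i - (μ : ZMod p).val * projExp μ (i + 1) : ℤ) : ZMod p) = 0 := by
      push_cast
      rw [cast_projExp, cast_projExp, ZMod.natCast_zmod_val, ← Units.val_mul, pow_succ',
        mul_inv_cancel_left, sub_self]
    obtain ⟨z, hz⟩ := (ZMod.intCast_zmod_eq_zero_iff_dvd _ p).mp this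
    exact ⟨z, by linarith⟩
  choose z hz using hz
  refine ⟨∏ i ∈ Finset.range (p - 1), f (i + 1) ^ z i, ?_⟩
  -- Reindex the projector by `i + 1`: the factors at `0` and `p - 1` coincide, so the cyclic shift
  -- does not change the product.
  have h1 := (Finset.prod_range_succ' (fun i ↦ f i ^ projExp μ i) (p - 1)).symm.trans
    (Finset.prod_range_succ _ (p - 1))
  rw [hfp, projExp_prime_sub_one, mul_left_inj] at h1
  conv_rhs => rw [← h1]
  rw [map_prod, ← Finset.prod_pow, ← Finset.prod_pow, ← Finset.prod_mul_distrib]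
  refine Finset.prod_congr rfl fun i _ ↦ ?_
  rw [map_pow, hf, ← zpow_natCast, hz i, zpow_add, mul_comm (p : ℤ), zpow_mul, zpow_mul,
    zpow_natCast, zpow_natCast, zpow_natCast, pow_right_comm]

end Projector

/-! ### Units with nontrivial projection -/

section Units

open NumberField

variable {p : ℕ} [Fact p.Prime] {K : Type*} [Field K] [NumberField K] [IsCyclotomicExtension {p} ℚ K]
    {ζ : K} (hζ : IsPrimitiveRoot ζ p)
    {u : ℕ} (hu : IsPrimitiveRoot (u : ZMod p) (p - 1)) {σ : K ≃ₐ[ℚ] K} (hσ : σ ζ = ζ ^ u)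

include hu in
theorem primitiveRoot_pow_half_eq_neg_one {s : ℕ} (hs : 2 * s = p - 1) (hs0 : 0 < s) :
    (u : ZMod p) ^ s = -1 := by
  have h1 : ((u : ZMod p) ^ s) ^ 2 = 1 := by rw [← pow_mul, mul_comm, hs, hu.pow_eq_one]
  refine (by simpa using h1 : (u : ZMod p) ^ s = 1 ∨ (u : ZMod p) ^ s = -1).resolve_left ?_
  exact hu.pow_ne_one_of_pos_of_lt hs0.ne' (by omega)

include hζ in
theorem conj_embedding_zeta (φ : K →+* ℂ) : (starRingEnd ℂ) (φ ζ) = φ ζ⁻¹ := by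
  have h : ‖φ ζ‖ = 1 := by
    apply Complex.norm_eq_one_of_pow_eq_one (n := p) _ (NeZero.ne p)
    rw [← map_pow, hζ.pow_eq_one, map_one]
  rw [map_inv₀, Complex.inv_eq_conj h]

include hζ hσ hu in
theorem half_pow_apply_zeta {s : ℕ} (hs : 2 * s = p - 1) (hs0 : 0 < s) : (σ ^ s) ζ = ζ⁻¹ := by
  rw [pow_apply_zeta hσ]
  apply eq_inv_of_mul_eq_one_left
  rw [← pow_succ, ← pow_zero ζ, zeta_pow_eq_iff hζ]
  push_cast
  rw [primitiveRoot_pow_half_eq_neg_one hu hs hs0, neg_add_cancel]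

include hζ hσ hu in
theorem infinitePlace_half_pow_apply {s : ℕ} (hs : 2 * s = p - 1) (hs0 : 0 < s)
    (w : InfinitePlace K) (x : K) : w ((σ ^ s) x) = w x := by
  have h : w.embedding.comp ((σ ^ s : K ≃ₐ[ℚ] K) : K →+* K) =
      ComplexEmbedding.conjugate w.embedding := by
    have := (hζ.powerBasis ℚ).algHom_ext
      (f := (w.embedding.comp ((σ ^ s : K ≃ₐ[ℚ] K) : K →+* K)).toRatAlgHom)
      (g := (ComplexEmbedding.conjugate w.embedding).toRatAlgHom) (by
        rw [hζ.powerBasis_gen ℚ]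
        change w.embedding ((σ ^ s) ζ) = (starRingEnd ℂ) (w.embedding ζ)
        rw [conj_embedding_zeta hζ, half_pow_apply_zeta hζ hu hσ hs hs0])
    ext x
    exact DFunLike.congr_fun this x
  have h1 : w ((σ ^ s) x) = ‖w.embedding.comp ((σ ^ s : K ≃ₐ[ℚ] K) : K →+* K) x‖ :=
    (InfinitePlace.norm_embedding_eq w _).symm
  rw [h1, h, ComplexEmbedding.conjugate_coe_eq, RCLike.norm_conj, InfinitePlace.norm_embedding_eq]

include hζ hσ hu in
-- Fixing `w` means fixing its embedding up to conjugation, so `u ^ k = ±1` and `u ^ (2k) = 1`,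
-- although `0 < 2k < p - 1`.
theorem infinitePlace_comap_pow_ne {s : ℕ} (hs : 2 * s = p - 1) (w : InfinitePlace K) {k : ℕ}
    (hk0 : 0 < k) (hk : k < s) : w.comap ((σ ^ k : K ≃ₐ[ℚ] K) : K →+* K) ≠ w := by
  intro h
  have h1 : InfinitePlace.mk (w.embedding.comp ((σ ^ k : K ≃ₐ[ℚ] K) : K →+* K)) =
      InfinitePlace.mk w.embedding := by
    rw [← InfinitePlace.comap_mk, InfinitePlace.mk_embedding, h]
  have h2 : (u : ZMod p) ^ k = 1 ∨ (u : ZMod p) ^ k = -1 := by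
    rcases InfinitePlace.mk_eq_iff.mp h1 with h1 | h1
    · left
      have h2 : w.embedding ((σ ^ k) ζ) = w.embedding ζ := DFunLike.congr_fun h1 ζ
      have h3 := w.embedding.injective h2
      rw [pow_apply_zeta hσ] at h3
      nth_rw 2 [← pow_one ζ] at h3
      rw [zeta_pow_eq_iff hζ] at h3
      simpa using h3
    · right
      have h2 : (starRingEnd ℂ) (w.embedding ((σ ^ k) ζ)) = w.embedding ζ :=
        DFunLike.congr_fun h1 ζ
      rw [pow_apply_zeta hσ, map_pow, map_pow, conj_embedding_zeta hζ, ← map_pow] at h2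
      have h3 := w.embedding.injective h2
      have h4 := congrArg (ζ ^ u ^ k * ·) h3
      simp only [← mul_pow, mul_inv_cancel₀ (hζ.ne_zero (NeZero.ne p)), one_pow] at h4
      have h3 : ζ ^ (u ^ k + 1) = ζ ^ 0 := by rw [pow_succ, ← h4, pow_zero]
      rw [zeta_pow_eq_iff hζ] at h3
      push_cast at h3
      exact eq_neg_of_add_eq_zero_left h3
  have h3 : (u : ZMod p) ^ (2 * k) = 1 := by
    rcases h2 with h2 | h2 <;> rw [mul_comm, pow_mul, h2] <;> simp
  exact hu.pow_ne_one_of_pos_of_lt (by omega) (by omega) h3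

include hζ hσ hu in
-- The sum over all `2s` conjugates is the logarithm of the absolute norm, which is `0`; its two
-- halves agree since `σ ^ s` preserves `w`.
theorem sum_log_conj_unit_eq_zero {s : ℕ} (hs : 2 * s = p - 1) (hs0 : 0 < s) (w : InfinitePlace K)
    (η : (𝓞 K)ˣ) : ∑ k ∈ Finset.range s, Real.log (w ((σ ^ k) (η : K))) = 0 := by
  have h1 : ∑ k ∈ Finset.range (2 * s), Real.log (w ((σ ^ k) (η : K))) = 0 := by
    rw [hs, ← Real.log_prod (fun k _ ↦ (map_ne_zero w).mpr
      ((map_ne_zero (σ ^ k)).mpr (NumberField.Units.coe_ne_zero η))), ← map_prod, prod_range_pow_apply hζ hu hσ]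
    have : w (algebraMap ℚ K (Algebra.norm ℚ (η : K))) = |((Algebra.norm ℚ (η : K) : ℚ) : ℝ)| := by
      rw [← InfinitePlace.norm_embedding_eq]
      simp
    rw [this, ← Rat.cast_abs, NumberField.Units.norm]
    simp
  rw [two_mul, Finset.sum_range_add] at h1
  have h2 : ∀ k, w ((σ ^ (s + k)) (η : K)) = w ((σ ^ k) (η : K)) := by
    intro k
    rw [pow_add, AlgEquiv.mul_apply, infinitePlace_half_pow_apply hζ hu hσ hs hs0]
  simp only [h2] at h1
  linarith

include hζ hσ hu in
/-- For each even nontrivial eigenvalue `μ`, some unit has a projection to the `μ`-eigenspace which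
is not a `p`-th power. -/
theorem exists_unit_proj_ne_pow {s : ℕ} (hs : 2 * s = p - 1) (hs0 : 0 < s) (μ : (ZMod p)ˣ)
    (hμ : (μ : ZMod p) ^ s = 1) (hμ1 : (μ : ZMod p) ≠ 1) :
    ∃ η : (𝓞 K)ˣ, ¬ ∃ x : K,
      x ^ p = ∏ i ∈ Finset.range (p - 1), (σ ^ i) (η : K) ^ projExp μ i := by
  obtain ⟨w⟩ := (inferInstance : Nonempty (InfinitePlace K))
  -- This unit has absolute value less than `1` at every place other than `w`, which is the sign
  -- pattern required of `l`.
  obtain ⟨η, hη⟩ := NumberField.Units.dirichletUnitTheorem.exists_unit K w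
  let T : Module.End ℤ (Additive (𝓞 K)ˣ) :=
    (MonoidHom.toAdditive (Units.map ((intAut σ : 𝓞 K ≃+* 𝓞 K) : 𝓞 K →* 𝓞 K))).toIntLinearMap
  let l : Additive (𝓞 K)ˣ →+ ℝ :=
    { toFun := fun x ↦ Real.log (w ((x.toMul : (𝓞 K)ˣ) : K))
      map_zero' := by simp
      map_add' := fun x y ↦ by simp [Real.log_mul] }
  have hT : ∀ (k : ℕ) (x : Additive (𝓞 K)ˣ),
      ((((T ^ k) x).toMul : (𝓞 K)ˣ) : K) = (σ ^ k) ((x.toMul : (𝓞 K)ˣ) : K) := by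
    intro k
    induction k with
    | zero => intro x; rfl
    | succ k ih => intro x; rw [pow_succ, pow_succ]; exact ih _
  have hlT : ∀ (k : ℕ) (x : Additive (𝓞 K)ˣ),
      l ((T ^ k) x) = Real.log (w ((σ ^ k) ((x.toMul : (𝓞 K)ˣ) : K))) := fun k x ↦ by
    rw [← hT]; rfl
  have hgeom : ∑ k ∈ Finset.range s, (μ : ZMod p) ^ k = 0 := by
    have := geom_sum_mul (μ : ZMod p) s
    rw [hμ, sub_self] at this
    exact (mul_eq_zero.mp this).resolve_right (sub_ne_zero.mpr hμ1)
  obtain ⟨x, hx⟩ := exists_aeval_apply_ne_smul (p := p) hs0 T l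
    (fun x ↦ by rw [hlT, infinitePlace_half_pow_apply hζ hu hσ hs hs0]; rfl) (Additive.ofMul η)
    (fun k hk0 hk ↦ by
      rw [hlT]
      exact hη _ (infinitePlace_comap_pow_ne hζ hu hσ hs w hk0 hk))
    (by simp only [hlT]; exact sum_log_conj_unit_eq_zero hζ hu hσ hs hs0 w η)
    (∑ i ∈ Finset.range (p - 1), Polynomial.C (projExp μ i : ℤ) * Polynomial.X ^ i)
    (μ := (μ : ZMod p)) hgeom (by
      have : Polynomial.aeval (μ : ZMod p)
          (∑ i ∈ Finset.range (p - 1), Polynomial.C (projExp μ i : ℤ) * Polynomial.X ^ i) = -1 := by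
        rw [← sum_projExp_mul_pow μ]
        simp
      rw [this]
      exact neg_ne_zero.mpr one_ne_zero)
  refine ⟨x.toMul, ?_⟩
  rintro ⟨y, hy⟩
  have hE : ((((Polynomial.aeval T
      (∑ i ∈ Finset.range (p - 1), Polynomial.C (projExp μ i : ℤ) * Polynomial.X ^ i)) x).toMul :
      (𝓞 K)ˣ) : K) = y ^ p := by
    rw [hy, map_sum, LinearMap.sum_apply, toMul_sum]
    have : ∀ g : ℕ → (𝓞 K)ˣ, ((∏ i ∈ Finset.range (p - 1), g i : (𝓞 K)ˣ) : K) =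
        ∏ i ∈ Finset.range (p - 1), (g i : K) := fun g ↦ by
      simp
    rw [this]
    refine Finset.prod_congr rfl fun i _ ↦ ?_
    rw [map_mul, Polynomial.aeval_C, map_pow, Polynomial.aeval_X, Module.End.mul_apply]
    rw [← hT, ← NumberField.Units.coe_pow]
    congr 1
  -- A `p`-th root in `K` of a unit is itself a unit, so failure to be a `p`-th power in the unit
  -- group carries over to `K`.
  have hyint : IsIntegral ℤ y := by
    apply IsIntegral.of_pow (Fact.out : p.Prime).pos
    rw [← hE]
    exact NumberField.RingOfIntegers.isIntegral_coe _
  obtain ⟨y', rfl⟩ : ∃ y' : 𝓞 K, (y' : K) = y := ⟨⟨y, hyint⟩, rfl⟩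
  have hunit : IsUnit y' := by
    apply (isUnit_pow_iff (NeZero.ne p)).mp
    rw [show y' ^ p = _ from NumberField.RingOfIntegers.ext hE.symm]
    exact Units.isUnit _
  obtain ⟨v, rfl⟩ := hunit
  apply hx (Additive.ofMul v)
  apply Additive.toMul.injective
  apply NumberField.Units.coe_injective
  refine hE.trans ?_
  simp

end Units

/-! ### Eigenvalues on positive classes -/

section Classes

variable {p : ℕ} [Fact p.Prime] {K : Type*} [Field K] [NumberField K]

theorem coe_conjIdeal (σ : K ≃ₐ[ℚ] K) (b : (Ideal (𝓞 K))⁰) :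
    (conjIdeal σ b : Ideal (𝓞 K)) = (b : Ideal (𝓞 K)).map (intAut σ : 𝓞 K →+* 𝓞 K) := rfl

theorem mk0_conjIdeal_eq (σ : K ≃ₐ[ℚ] K) {I J : (Ideal (𝓞 K))⁰}
    (h : ClassGroup.mk0 I = ClassGroup.mk0 J) :
    ClassGroup.mk0 (conjIdeal σ I) = ClassGroup.mk0 (conjIdeal σ J) := by
  obtain ⟨x, y, hx, hy, hxy⟩ := ClassGroup.mk0_eq_mk0_iff.mp h
  refine ClassGroup.mk0_eq_mk0_iff.mpr ⟨intAut σ x, intAut σ y, ?_, ?_, ?_⟩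
  · exact (map_ne_zero_iff _ (intAut σ).injective).mpr hx
  · exact (map_ne_zero_iff _ (intAut σ).injective).mpr hy
  · have := congrArg (Ideal.map (intAut σ : 𝓞 K →+* 𝓞 K)) hxy
    simp only [Ideal.map_mul, Ideal.map_span, Set.image_singleton] at this
    exact this

theorem conjIdeal_pow (σ : K ≃ₐ[ℚ] K) (b : (Ideal (𝓞 K))⁰) (n : ℕ) :
    conjIdeal σ (b ^ n) = conjIdeal σ b ^ n := by
  apply Subtype.ext
  simp [coe_conjIdeal, Ideal.map_pow]

theorem coe_conjIdeal_pow (σ : K ≃ₐ[ℚ] K) (b : (Ideal (𝓞 K))⁰) (k : ℕ) :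
    (conjIdeal (σ ^ k) b : Ideal (𝓞 K)) =
      (b : Ideal (𝓞 K)).map ((intAut σ ^ k : 𝓞 K ≃+* 𝓞 K) : 𝓞 K →+* 𝓞 K) := by
  rw [intAut_pow]
  rfl

theorem mk0_conjIdeal_pow (σ : K ≃ₐ[ℚ] K) {b : (Ideal (𝓞 K))⁰} {n : ℕ}
    (h : ClassGroup.mk0 (conjIdeal σ b) = ClassGroup.mk0 b ^ n) (k : ℕ) :
    ClassGroup.mk0 (conjIdeal (σ ^ k) b) = ClassGroup.mk0 b ^ n ^ k := by
  induction k with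
  | zero =>
    have : conjIdeal (σ ^ 0) b = b := Subtype.ext (by
      rw [coe_conjIdeal_pow, pow_zero]
      exact Ideal.map_id _)
    rw [this, pow_zero, pow_one]
  | succ k ih =>
    have h1 : conjIdeal (σ ^ (k + 1)) b = conjIdeal σ (conjIdeal (σ ^ k) b) := Subtype.ext (by
      rw [coe_conjIdeal_pow, coe_conjIdeal, coe_conjIdeal_pow, map_map_pow])
    rw [h1, mk0_conjIdeal_eq σ (J := b ^ n ^ k) (by rw [ih, map_pow]), conjIdeal_pow, map_pow, h,
      ← pow_mul, pow_succ']

theorem pow_eq_one_of_mem_positiveClasses {ζ : K} {c : ClassGroup (𝓞 K)}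
    (hc : c ∈ positiveClasses p ζ) : c ^ p = 1 := by
  obtain ⟨d, hd, rfl⟩ := Subgroup.mem_map.mp hc
  rw [← map_pow, show d ^ p = 1 from hd, map_one]

/-- An automorphism which inverts `ζ` fixes the classes extended from the real subfield. -/
theorem mk0_conjIdeal_of_mem_positiveClasses {ζ : K} {τ : K ≃ₐ[ℚ] K} (hτ : τ ζ = ζ⁻¹)
    {b : (Ideal (𝓞 K))⁰} (hb : ClassGroup.mk0 b ∈ positiveClasses p ζ) :
    ClassGroup.mk0 (conjIdeal τ b) = ClassGroup.mk0 b := by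
  obtain ⟨d, -, hd⟩ := Subgroup.mem_map.mp hb
  obtain ⟨I, rfl⟩ := ClassGroup.mk0_surjective d
  rw [ClassGroup.extendedHom_mk0] at hd
  have hfix : ∀ x ∈ realSubfield ζ, τ x = x := by
    intro x hx
    induction hx using IntermediateField.adjoin_induction with
    | mem x hx =>
      rw [Set.mem_singleton_iff] at hx
      rw [hx, map_add, map_inv₀, hτ, inv_inv, add_comm]
    | algebraMap q => exact τ.commutes q
    | add x y _ _ hx hy => rw [map_add, hx, hy]
    | inv x _ hx => rw [map_inv₀, hx]
    | mul x y _ _ hx hy => rw [map_mul, hx, hy]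
  have hcomp : (intAut τ : 𝓞 K →+* 𝓞 K).comp (algebraMap (𝓞 (realSubfield ζ)) (𝓞 K)) =
      algebraMap (𝓞 (realSubfield ζ)) (𝓞 K) := by
    ext x
    exact hfix _ (x : realSubfield ζ).2
  rw [← mk0_conjIdeal_eq τ hd, ← hd]
  congr 1
  apply Subtype.ext
  rw [coe_conjIdeal, Ideal.map_map, hcomp]

variable [IsCyclotomicExtension {p} ℚ K] {ζ : K} (hζ : IsPrimitiveRoot ζ p)
    {u : ℕ} (hu : IsPrimitiveRoot (u : ZMod p) (p - 1)) {σ : K ≃ₐ[ℚ] K} (hσ : σ ζ = ζ ^ u)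

include hζ hσ hu in
-- Complex conjugation `σ ^ s` fixes the class but also raises it to the power `μ ^ s`; the class
-- has order exactly `p`.
theorem eigenvalue_pow_half_eq_one {s : ℕ} (hs : 2 * s = p - 1) (hs0 : 0 < s)
    {b : (Ideal (𝓞 K))⁰} (hb : ClassGroup.mk0 b ∈ positiveClasses p ζ) {μ : ZMod p}
    (hμ : AnnihilatedBy σ μ b) (hb1 : ClassGroup.mk0 b ≠ 1) : μ ^ s = 1 := by
  have h1 := mk0_conjIdeal_pow σ hμ s
  rw [mk0_conjIdeal_of_mem_positiveClasses (half_pow_apply_zeta hζ hu hσ hs hs0) hb] at h1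
  have hord := orderOf_eq_prime (pow_eq_one_of_mem_positiveClasses hb) hb1
  nth_rw 1 [← pow_one (ClassGroup.mk0 b)] at h1
  rw [pow_eq_pow_iff_modEq, hord, ← ZMod.natCast_eq_natCast_iff] at h1
  rw [Nat.cast_pow, ZMod.natCast_zmod_val, Nat.cast_one] at h1
  exact h1.symm

include hζ hσ hu in
-- For `μ = 1` all conjugates of `b` have one class `c`, so principality of their product gives `c ^
-- (p - 1) = 1`, against `c ^ p = 1` and `c ≠ 1`.
theorem eigenvalue_ne_one {b : (Ideal (𝓞 K))⁰}
    (hb : ClassGroup.mk0 b ∈ positiveClasses p ζ) {μ : ZMod p}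
    (hμ : AnnihilatedBy σ μ b) (hb1 : ClassGroup.mk0 b ≠ 1) : μ ≠ 1 := by
  rintro rfl
  have hp1 : 1 < p := (Fact.out : p.Prime).one_lt
  have : Fact (1 < p) := ⟨hp1⟩
  have h1 : ∀ k, ClassGroup.mk0 (conjIdeal (σ ^ k) b) = ClassGroup.mk0 b := fun k ↦ by
    rw [mk0_conjIdeal_pow σ hμ k, ZMod.val_one, one_pow, pow_one]
  have h2 : ClassGroup.mk0 (∏ k ∈ Finset.range (p - 1), conjIdeal (σ ^ k) b) = 1 := by
    refine (ClassGroup.mk0_eq_one_iff (Subtype.prop _)).mpr ?_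
    have := prod_conj_isPrincipal hζ hu hσ (b : Ideal (𝓞 K))
    rw [conjProd_apply] at this
    have hprod : ((∏ k ∈ Finset.range (p - 1), conjIdeal (σ ^ k) b : (Ideal (𝓞 K))⁰) :
        Ideal (𝓞 K)) = ∏ k ∈ Finset.range (p - 1),
          (b : Ideal (𝓞 K)).map ((intAut σ ^ k : 𝓞 K ≃+* 𝓞 K) : 𝓞 K →+* 𝓞 K) := by
      rw [SubmonoidClass.coe_finsetProd]
      exact Finset.prod_congr rfl fun k _ ↦ coe_conjIdeal_pow σ b k
    rwa [← hprod] at this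
  rw [map_prod, Finset.prod_congr rfl fun k _ ↦ h1 k, Finset.prod_const, Finset.card_range] at h2
  have h3 := pow_eq_one_of_mem_positiveClasses hb
  rw [← Nat.sub_add_cancel hp1.le, pow_succ, h2, one_mul] at h3
  exact hb1 h3

theorem val_eq_rootPow_iff (μ : ZMod p) (n : ℕ) : μ.val = rootPow p u n ↔ μ = (u : ZMod p) ^ n := by
  rw [rootPow, ← ZMod.val_natCast, (ZMod.val_injective p).eq_iff, Nat.cast_pow]

include hu in
theorem exists_eq_even_pow {s : ℕ} (hs : 2 * s = p - 1) (hs0 : 0 < s) {μ : ZMod p}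
    (hμ : μ ^ s = 1) (hμ1 : μ ≠ 1) : ∃ m, 1 ≤ m ∧ m ≤ (p - 3) / 2 ∧ μ = (u : ZMod p) ^ (2 * m) := by
  have : NeZero (p - 1) := ⟨by omega⟩
  obtain ⟨j, hj, rfl⟩ := hu.eq_pow_of_pow_eq_one (ξ := μ) (by
    rw [← hs, mul_comm, pow_mul, hμ, one_pow])
  rw [← pow_mul, hu.pow_eq_one_iff_dvd, ← hs] at hμ
  obtain ⟨m, rfl⟩ := Nat.dvd_of_mul_dvd_mul_right hs0 hμ
  refine ⟨m, ?_, by omega, rfl⟩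
  by_contra h0
  exact hμ1 (by rw [show m = 0 by omega]; simp)

end Classes

/-! ### Semi-primarity and the exact power of `π` -/

section Singular

variable {p : ℕ} [Fact p.Prime] {K : Type*} [Field K] [NumberField K] [IsCyclotomicExtension {p} ℚ K]
    {ζ : K} (hζ : IsPrimitiveRoot ζ p)
    {u : ℕ} (hu : IsPrimitiveRoot (u : ZMod p) (p - 1)) {σ : K ≃ₐ[ℚ] K} (hσ : σ ζ = ζ ^ u)

theorem mem_piIdeal_pow_iff (n : ℕ) (x : 𝓞 K) :
    x ∈ piIdeal hζ ^ n ↔ (1 - hζ.toInteger) ^ n ∣ x := by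
  rw [piIdeal, Ideal.span_singleton_pow, Ideal.mem_span_singleton]

theorem piIdeal_prime : Prime (piIdeal hζ) :=
  Ideal.prime_span_singleton_iff.mpr (one_sub_prime hζ)

theorem not_one_sub_dvd_of_span_eq_pow {b : Ideal (𝓞 K)} (hb : ¬ piIdeal hζ ∣ b) {B : 𝓞 K}
    (hB : Ideal.span {B} = b ^ p) : ¬ 1 - hζ.toInteger ∣ B := by
  intro h
  apply hb
  apply (piIdeal_prime hζ).dvd_of_dvd_pow (n := p)
  rw [← hB, piIdeal, Ideal.dvd_span_singleton, Ideal.mem_span_singleton]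
  exact h

include hσ in
theorem sq_dvd_intAut_one_sub : (1 - hζ.toInteger) ^ 2 ∣
    (intAut σ : 𝓞 K →+* 𝓞 K) (1 - hζ.toInteger) - u * (1 - hζ.toInteger) := by
  have h1 : intAut σ hζ.toInteger = hζ.toInteger ^ u := NumberField.RingOfIntegers.ext hσ
  have h2 := sq_dvd_add_pow_sub_sub (-(1 - hζ.toInteger)) 1 u
  rw [← dvd_neg]
  convert h2 using 1
  · ring
  · simp [h1]
    ring

include hσ in
-- Clears the denominator of `α` without introducing a factor `l`, so that the local congruences
-- apply.
theorem exists_integral_relation {b : Ideal (𝓞 K)} (hb : ¬ piIdeal hζ ∣ b) {B : 𝓞 K}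
    (hB : Ideal.span {B} = b ^ p) {n : ℕ} {α : K} (hα : σ (B : K) = (B : K) ^ n * α ^ p) :
    ∃ x y : 𝓞 K, intAut σ B * y ^ p = B ^ n * x ^ p ∧ ¬ 1 - hζ.toInteger ∣ x ∧
      ¬ 1 - hζ.toInteger ∣ y := by
  have hpr := one_sub_prime hζ
  -- Any `y ∈ b ^ n` outside `π` is a suitable denominator: `B ^ n` divides `y ^ p`, so `(α y) ^ p`
  -- is integral.
  have hnle : ¬ b ^ n ≤ piIdeal hζ := fun h ↦
    hb ((piIdeal_prime hζ).dvd_of_dvd_pow (Ideal.dvd_iff_le.mpr h))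
  obtain ⟨y, hyb, hyπ⟩ := SetLike.not_le_iff_exists.mp hnle
  rw [piIdeal, Ideal.mem_span_singleton] at hyπ
  have hyp : B ^ n ∣ y ^ p := by
    rw [← Ideal.mem_span_singleton, ← Ideal.span_singleton_pow, hB, pow_right_comm]
    exact Ideal.pow_mem_pow hyb p
  obtain ⟨z, hz⟩ := hyp
  have hz' : (y : K) ^ p = (B : K) ^ n * z := by exact_mod_cast congrArg (algebraMap (𝓞 K) K) hz
  have hX : (α * y) ^ p = ((intAut σ B * z : 𝓞 K) : K) := by
    have : ((intAut σ B * z : 𝓞 K) : K) = σ (B : K) * z := rfl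
    rw [mul_pow, hz', this, hα]
    ring
  have hint : IsIntegral ℤ (α * y) := by
    apply IsIntegral.of_pow (Fact.out : p.Prime).pos
    rw [hX]
    exact NumberField.RingOfIntegers.isIntegral_coe _
  obtain ⟨x, hx⟩ : ∃ x : 𝓞 K, (x : K) = α * y := ⟨⟨_, hint⟩, rfl⟩
  have hrel : intAut σ B * y ^ p = B ^ n * x ^ p := by
    apply NumberField.RingOfIntegers.ext
    simp only [map_mul, map_pow, hx, coe_intAut, hα]
    ring
  refine ⟨x, y, hrel, fun hlx ↦ ?_, hyπ⟩
  have h1 : 1 - hζ.toInteger ∣ intAut σ B * y ^ p := by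
    rw [hrel]
    exact (dvd_pow hlx (NeZero.ne p)).mul_left _
  have h2 := (hpr.dvd_or_dvd h1).resolve_right fun h ↦ hyπ (hpr.dvd_of_dvd_pow h)
  -- If `l` divided `x` it would divide `σ(B)`; as `σ` fixes residues modulo `l`, it would then
  -- divide `B`.
  obtain ⟨a, t, ht⟩ := exists_int_one_sub_dvd_sub hζ B
  have h3 : 1 - hζ.toInteger ∣ (intAut σ : 𝓞 K →+* 𝓞 K) (1 - hζ.toInteger) := by
    have := (dvd_pow_self _ two_ne_zero).trans (sq_dvd_intAut_one_sub hζ hσ)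
    exact (dvd_sub_left (dvd_mul_left _ _)).mp this
  have h4 : 1 - hζ.toInteger ∣ (a : 𝓞 K) := by
    have : (a : 𝓞 K) = intAut σ B -
        (intAut σ : 𝓞 K →+* 𝓞 K) (1 - hζ.toInteger) * (intAut σ : 𝓞 K →+* 𝓞 K) t := by
      rw [← map_mul, ← ht]
      simp
    rw [this]
    exact dvd_sub h2 (h3.mul_right _)
  apply not_one_sub_dvd_of_span_eq_pow hζ hb hB
  have : B = (1 - hζ.toInteger) * t + a := by rw [← ht]; ring
  rw [this]
  exact dvd_add (dvd_mul_right _ _) h4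

include hσ in
theorem root_pow_eq_of_exactly_dvd {b : Ideal (𝓞 K)} (hb : ¬ piIdeal hζ ∣ b) {B : 𝓞 K}
    (hB : Ideal.span {B} = b ^ p) {μ : ZMod p} {α : K}
    (hα : σ (B : K) = (B : K) ^ μ.val * α ^ p) {n : ℕ} (hn : 1 ≤ n) (hnp : n < p)
    (h : (1 - hζ.toInteger) ^ n ∣ B ^ (p - 1) - 1)
    (h' : ¬ (1 - hζ.toInteger) ^ (n + 1) ∣ B ^ (p - 1) - 1) : (u : ZMod p) ^ n = μ := by
  have hp := (Fact.out : p.Prime)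
  obtain ⟨x, y, hxy, hx, hy⟩ := exists_integral_relation hζ hσ hb hB hα
  have := dvd_pow_sub_of_exactly_dvd (one_sub_prime hζ) hp (one_sub_pow_dvd_prime hζ) hp.two_le
    (exists_int_one_sub_dvd_sub hζ) (dvd_intCast_of_one_sub_dvd hζ) (intAut σ : 𝓞 K →+* 𝓞 K)
    (sq_dvd_intAut_one_sub hζ hσ) hxy hx hy hn hnp h h'
  rw [← ZMod.intCast_zmod_eq_zero_iff_dvd] at this
  push_cast at this
  rw [ZMod.natCast_zmod_val] at this
  exact sub_eq_zero.mp this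

include hu hσ in
-- Otherwise `l` divides `B ^ (p - 1) - 1` exactly once, giving `u = u ^ (2m)` with `2 ≤ 2m < p -
-- 1`.
theorem exists_int_sub_mem_sq {b : Ideal (𝓞 K)} (hb : ¬ piIdeal hζ ∣ b) {B : 𝓞 K}
    (hB : Ideal.span {B} = b ^ p) {m : ℕ} (hm : 1 ≤ m) (hmp : 2 * m < p - 1) {μ : ZMod p}
    (hμ : μ = (u : ZMod p) ^ (2 * m)) {α : K} (hα : σ (B : K) = (B : K) ^ μ.val * α ^ p) :
    ∃ c : ℤ, ¬ (p : ℤ) ∣ c ∧ B - (c : 𝓞 K) ∈ piIdeal hζ ^ 2 := by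
  have hp := (Fact.out : p.Prime)
  have hlB := not_one_sub_dvd_of_span_eq_pow hζ hb hB
  have hdvd : (1 - hζ.toInteger) ^ 2 ∣ B ^ (p - 1) - 1 := by
    by_contra hcon
    have h1 := dvd_pow_sub_one_of_not_dvd hp (one_sub_pow_dvd_prime hζ) hp.two_le
      (exists_int_one_sub_dvd_sub hζ) hlB
    have := root_pow_eq_of_exactly_dvd hζ hσ hb hB hα le_rfl hp.one_lt (by rwa [pow_one]) hcon
    rw [hμ] at this
    have := hu.pow_inj (by omega) hmp this
    omega
  obtain ⟨c, hc, hcB⟩ := exists_int_pow_dvd_sub_pow hp (one_sub_pow_dvd_prime hζ) hp.two_le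
    (exists_int_one_sub_dvd_sub hζ) hlB hp.two_le hdvd
  refine ⟨c ^ p, fun h ↦ hc ((Nat.prime_iff_prime_int.mp hp).dvd_of_dvd_pow h), ?_⟩
  rw [mem_piIdeal_pow_iff]
  exact_mod_cast hcB

include hu hσ in
theorem piExactlyDivides_of_not_primary {b : Ideal (𝓞 K)} (hb : ¬ piIdeal hζ ∣ b) {B : 𝓞 K}
    (hB : Ideal.span {B} = b ^ p) {m : ℕ} (hm : 1 ≤ m) (hmp : 2 * m < p - 1) {μ : ZMod p}
    (hμ : μ = (u : ZMod p) ^ (2 * m)) {α : K} (hα : σ (B : K) = (B : K) ^ μ.val * α ^ p)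
    (hsing : IsSingular p B) (hprim : ¬ IsSingularPrimary hζ B) :
    PiExactlyDivides hζ (2 * m) (B ^ (p - 1) - 1) := by
  classical
  have hp := (Fact.out : p.Prime)
  have hlB := not_one_sub_dvd_of_span_eq_pow hζ hb hB
  have h1 := dvd_pow_sub_one_of_not_dvd hp (one_sub_pow_dvd_prime hζ) hp.two_le
      (exists_int_one_sub_dvd_sub hζ) hlB
  have hnp : ¬ (1 - hζ.toInteger) ^ p ∣ B ^ (p - 1) - 1 := by
    intro h
    obtain ⟨c, hc, hcB⟩ := exists_int_pow_dvd_sub_pow hp (one_sub_pow_dvd_prime hζ) hp.two_le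
      (exists_int_one_sub_dvd_sub hζ) hlB le_rfl h
    exact hprim ⟨hsing, c, hc, (mem_piIdeal_pow_iff hζ p _).mpr hcB⟩
  have hex : ∃ n, ¬ (1 - hζ.toInteger) ^ (n + 1) ∣ B ^ (p - 1) - 1 :=
    ⟨p - 1, by rwa [Nat.sub_add_cancel hp.one_le]⟩
  obtain ⟨n, hn, hmin⟩ : ∃ n, ¬ (1 - hζ.toInteger) ^ (n + 1) ∣ B ^ (p - 1) - 1 ∧
      ∀ k < n, (1 - hζ.toInteger) ^ (k + 1) ∣ B ^ (p - 1) - 1 :=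
    ⟨Nat.find hex, Nat.find_spec hex, fun k hk ↦ not_not.mp (Nat.find_min hex hk)⟩
  have hn0 : 1 ≤ n := by
    by_contra h0
    rw [show n = 0 by omega, zero_add, pow_one] at hn
    exact hn h1
  have hn' : (1 - hζ.toInteger) ^ n ∣ B ^ (p - 1) - 1 := by
    have := hmin (n - 1) (by omega)
    rwa [Nat.sub_add_cancel hn0] at this
  have hnlt : n < p := by
    by_contra hge
    exact hnp ((pow_dvd_pow _ (by omega)).trans hn')
  have hun := root_pow_eq_of_exactly_dvd hζ hσ hb hB hα hn0 hnlt hn' hn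
  rw [hμ] at hun
  have hn2 : n = 2 * m := by
    -- The exponent `p - 1` lies just outside the range where powers of `u` are distinct; it would
    -- give `μ = 1`.
    by_cases hlast : n = p - 1
    · rw [hlast, hu.pow_eq_one] at hun
      exact absurd hun.symm (hu.pow_ne_one_of_pos_of_lt (by omega) hmp)
    · exact hu.pow_inj (by omega) hmp hun
  subst hn2
  rw [PiExactlyDivides, mem_piIdeal_pow_iff, mem_piIdeal_pow_iff]
  exact ⟨hn', hn⟩

end Singular

/-! ### Construction of singular integers -/

section Existence

variable {p : ℕ} [Fact p.Prime] {K : Type*} [Field K] [NumberField K] [IsCyclotomicExtension {p} ℚ K]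
    {ζ : K} (hζ : IsPrimitiveRoot ζ p)
    {u : ℕ} (hu : IsPrimitiveRoot (u : ZMod p) (p - 1)) {σ : K ≃ₐ[ℚ] K} (hσ : σ ζ = ζ ^ u)

include hζ hσ hu in
theorem exists_apply_proj_eq (μ : (ZMod p)ˣ) {x : K} (hx : x ≠ 0) :
    ∃ y : K, y ≠ 0 ∧ σ (∏ i ∈ Finset.range (p - 1), (σ ^ i) x ^ projExp μ i) =
      (∏ i ∈ Finset.range (p - 1), (σ ^ i) x ^ projExp μ i) ^ (μ : ZMod p).val * y ^ p := by
  obtain ⟨y, hy⟩ := exists_map_prod_pow_projExp_eq μ (Units.map (σ : K →* K))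
    (fun i ↦ Units.map ((σ ^ i : K ≃ₐ[ℚ] K) : K →* K) (Units.mk0 x hx))
    (fun i ↦ by
      ext
      simp only [Units.coe_map, pow_succ']
      rfl)
    (by simp only [pow_prime_sub_one_eq_one hζ hu hσ, pow_zero])
  refine ⟨y, y.ne_zero, ?_⟩
  have := congrArg (Units.val) hy
  simpa using this

/-- The algebraic integer `∏ σ ^ i (x) ^ {μ ^ (-i)}`. -/
noncomputable def intProj (σ : K ≃ₐ[ℚ] K) (μ : (ZMod p)ˣ) (x : 𝓞 K) : 𝓞 K :=
  ∏ i ∈ Finset.range (p - 1), (intAut σ ^ i) x ^ projExp μ i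

theorem coe_intProj (σ : K ≃ₐ[ℚ] K) (μ : (ZMod p)ˣ) (x : 𝓞 K) :
    (intProj σ μ x : K) = ∏ i ∈ Finset.range (p - 1), (σ ^ i) (x : K) ^ projExp μ i := by
  rw [intProj, NumberField.RingOfIntegers.coe_eq_algebraMap, map_prod]
  refine Finset.prod_congr rfl fun i _ ↦ ?_
  rw [map_pow, ← NumberField.RingOfIntegers.coe_eq_algebraMap, coe_intAut_pow]

theorem intProj_ne_zero (σ : K ≃ₐ[ℚ] K) (μ : (ZMod p)ˣ) {x : 𝓞 K} (hx : x ≠ 0) :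
    intProj σ μ x ≠ 0 :=
  Finset.prod_ne_zero_iff.mpr fun i _ ↦
    pow_ne_zero _ ((map_ne_zero_iff _ (intAut σ ^ i).injective).mpr hx)

theorem isUnit_intProj (σ : K ≃ₐ[ℚ] K) (μ : (ZMod p)ˣ) {x : 𝓞 K} (hx : IsUnit x) :
    IsUnit (intProj σ μ x) := by
  rw [intProj, IsUnit.prod_iff]
  exact fun i _ ↦ (hx.map (intAut σ ^ i)).pow _

include hζ hσ hu in
-- The generator `β ^ p` is a `p`-th power, so it is twisted by the projection of a unit that is not
-- one.
theorem exists_generator_of_isPrincipal {s : ℕ} (hs : 2 * s = p - 1) (hs0 : 0 < s) {μ : (ZMod p)ˣ}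
    (hμ : (μ : ZMod p) ^ s = 1) (hμ1 : (μ : ZMod p) ≠ 1) {β : 𝓞 K} (hβ : β ≠ 0) :
    ∃ B : 𝓞 K, Ideal.span {B} = Ideal.span {β} ^ p ∧ (¬ ∃ x : K, x ^ p = (B : K)) ∧
      ∃ α : K, σ (B : K) = (B : K) ^ (μ : ZMod p).val * α ^ p := by
  obtain ⟨η, hη⟩ := exists_unit_proj_ne_pow hζ hu hσ hs hs0 μ hμ hμ1
  obtain ⟨y, hy0, hy⟩ := exists_apply_proj_eq hζ hu hσ μ (NumberField.Units.coe_ne_zero η)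
  have hβK : (β : K) ≠ 0 := NumberField.RingOfIntegers.coe_ne_zero_iff.mpr hβ
  have hB : ((β ^ p * intProj σ μ η : 𝓞 K) : K) = (β : K) ^ p * (intProj σ μ (η : 𝓞 K) : K) := by
    simp
  rw [← coe_intProj] at hη hy
  refine ⟨β ^ p * intProj σ μ η, ?_, ?_, σ (β : K) * (β : K)⁻¹ ^ (μ : ZMod p).val * y, ?_⟩
  · rw [Ideal.span_singleton_pow, Ideal.span_singleton_mul_right_unit
      (isUnit_intProj σ μ η.isUnit)]
  · rintro ⟨x, hx⟩
    apply hη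
    refine ⟨x / β, ?_⟩
    rw [div_pow, hx, hB, mul_div_cancel_left₀ _ (pow_ne_zero _ hβK)]
  · rw [hB, map_mul, hy, map_pow]
    have h1 : (β : K) ^ (μ : ZMod p).val * (β : K)⁻¹ ^ (μ : ZMod p).val = 1 := by
      rw [← mul_pow, mul_inv_cancel₀ hβK, one_pow]
    calc _ = (((β : K) ^ (μ : ZMod p).val * (β : K)⁻¹ ^ (μ : ZMod p).val) ^ p) *
          (σ (β : K) ^ p * ((intProj σ μ (η : 𝓞 K) : K) ^ (μ : ZMod p).val * y ^ p)) := by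
            rw [h1, one_pow, one_mul]
      _ = _ := by ring

include hζ hσ hu in
-- Projecting a generator of `b ^ p` changes the ideal to `d ^ p` with `d` in the inverse class of
-- `b`. Dividing `g ^ p` by it, where `(g) = d b`, restores the ideal `b ^ p` and keeps the
-- eigenvalue. A `p`-th root of the result would generate `b`.
theorem exists_generator_of_not_isPrincipal {μ : (ZMod p)ˣ} {b : (Ideal (𝓞 K))⁰}
    (hb : ClassGroup.mk0 b ^ p = 1) (hb1 : ClassGroup.mk0 b ≠ 1)
    (hμ : AnnihilatedBy σ (μ : ZMod p) b) :
    ∃ B : 𝓞 K, Ideal.span {B} = (b : Ideal (𝓞 K)) ^ p ∧ (¬ ∃ x : K, x ^ p = (B : K)) ∧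
      ∃ α : K, σ (B : K) = (B : K) ^ (μ : ZMod p).val * α ^ p := by
  have hp0 := NeZero.ne p
  have hbne : (b : Ideal (𝓞 K)) ≠ 0 := mem_nonZeroDivisors_iff_ne_zero.mp b.2
  obtain ⟨B₀, hB₀⟩ : ∃ B₀ : 𝓞 K, Ideal.span {B₀} = (b : Ideal (𝓞 K)) ^ p := by
    rw [← map_pow] at hb
    obtain ⟨B₀, h⟩ := (ClassGroup.mk0_eq_one_iff (Subtype.prop (b ^ p))).mp hb
    exact ⟨B₀, h.symm⟩
  have hB₀0 : B₀ ≠ 0 := by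
    rintro rfl
    rw [Ideal.span_singleton_zero] at hB₀
    exact pow_ne_zero p hbne hB₀.symm
  let d : (Ideal (𝓞 K))⁰ := ∏ i ∈ Finset.range (p - 1), conjIdeal (σ ^ i) b ^ projExp μ i
  have hd : Ideal.span {intProj σ μ B₀} = (d : Ideal (𝓞 K)) ^ p := by
    rw [intProj, ← Ideal.prod_span_singleton, SubmonoidClass.coe_finsetProd, ← Finset.prod_pow]
    refine Finset.prod_congr rfl fun i _ ↦ ?_
    have := congrArg (Ideal.map ((intAut σ ^ i : 𝓞 K ≃+* 𝓞 K) : 𝓞 K →+* 𝓞 K)) hB₀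
    rw [Ideal.map_span, Set.image_singleton, Ideal.map_pow, ← coe_conjIdeal_pow] at this
    rw [← Ideal.span_singleton_pow, SubmonoidClass.coe_pow, pow_right_comm, ← this]
    rfl
  have hcls : ClassGroup.mk0 (d * b) = 1 := by
    have h1 : ClassGroup.mk0 d = ClassGroup.mk0 b ^
        ∑ i ∈ Finset.range (p - 1), (μ : ZMod p).val ^ i * projExp μ i := by
      rw [← Finset.prod_pow_eq_pow_sum, map_prod]
      refine Finset.prod_congr rfl fun i _ ↦ ?_
      rw [map_pow, mk0_conjIdeal_pow σ hμ, ← pow_mul]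
    -- The exponent of the class is `∑ μ ^ i μ ^ (-i) + 1 = (p - 1) + 1`, which is `0` modulo `p`.
    rw [map_mul, h1, ← pow_succ, ← orderOf_dvd_iff_pow_eq_one, orderOf_eq_prime hb hb1,
      ← ZMod.natCast_eq_zero_iff]
    push_cast
    rw [ZMod.natCast_zmod_val, Finset.sum_congr rfl fun i _ ↦ mul_comm _ _, sum_projExp_mul_pow,
      neg_add_cancel]
  obtain ⟨g, hg⟩ := (ClassGroup.mk0_eq_one_iff (Subtype.prop (d * b))).mp hcls
  have hg : (d : Ideal (𝓞 K)) * b = Ideal.span {g} := hg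
  have hgp : Ideal.span {g ^ p} = Ideal.span {intProj σ μ B₀} * (b : Ideal (𝓞 K)) ^ p := by
    rw [hd, ← Ideal.span_singleton_pow, ← hg, mul_pow]
  have he0 : intProj σ μ B₀ ≠ 0 := intProj_ne_zero σ μ hB₀0
  obtain ⟨B, hB⟩ : intProj σ μ B₀ ∣ g ^ p := by
    rw [← Ideal.mem_span_singleton, ← Ideal.span_singleton_le_iff_mem, hgp]
    exact Ideal.mul_le_left
  have hspan : Ideal.span {B} = (b : Ideal (𝓞 K)) ^ p := by
    rw [hB, ← Ideal.span_singleton_mul_span_singleton] at hgp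
    exact (mul_left_cancel₀ (mt Ideal.span_singleton_eq_bot.mp he0) hgp :
      Ideal.span {B} = (b : Ideal (𝓞 K)) ^ p)
  refine ⟨B, hspan, ?_, ?_⟩
  · rintro ⟨x, hx⟩
    have hint : IsIntegral ℤ x := by
      apply IsIntegral.of_pow (Nat.pos_of_ne_zero hp0)
      rw [hx]
      exact NumberField.RingOfIntegers.isIntegral_coe _
    obtain ⟨x, rfl⟩ : ∃ x' : 𝓞 K, (x' : K) = x := ⟨⟨x, hint⟩, rfl⟩
    have hxB : x ^ p = B := NumberField.RingOfIntegers.ext (by simpa using hx)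
    rw [← hxB, ← Ideal.span_singleton_pow] at hspan
    have hxb : Ideal.span {x} = (b : Ideal (𝓞 K)) := by
      exact (pow_left_inj hp0).mp hspan
    exact hb1 ((ClassGroup.mk0_eq_one_iff b.2).mpr ⟨x, hxb.symm⟩)
  · obtain ⟨y, hy0, hy⟩ := exists_apply_proj_eq hζ hu hσ μ
      (NumberField.RingOfIntegers.coe_ne_zero_iff.mpr hB₀0)
    rw [← coe_intProj] at hy
    set e : K := (intProj σ μ B₀ : K) with he
    have he0 : e ≠ 0 := NumberField.RingOfIntegers.coe_ne_zero_iff.mpr he0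
    have hBK : (g : K) ^ p = e * B := by
      have := congrArg (algebraMap (𝓞 K) K) hB
      simpa using this
    have hB0 : (B : K) ≠ 0 := by
      intro h
      rw [NumberField.RingOfIntegers.coe_eq_zero_iff] at h
      rw [h, Ideal.span_singleton_zero] at hspan
      exact pow_ne_zero p hbne hspan.symm
    have hg0 : (g : K) ≠ 0 := by
      intro h
      rw [h, zero_pow hp0] at hBK
      exact mul_ne_zero he0 hB0 hBK.symm
    -- Comes from `B = g ^ p / e` and `σ(e) = e ^ μ y ^ p`: the powers of `e` cancel in `σ(B) / B ^
    -- μ`.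
    refine ⟨σ (g : K) / ((g : K) ^ (μ : ZMod p).val * y), ?_⟩
    have hσe : σ e ≠ 0 := (map_ne_zero σ).mpr he0
    have h1 : σ (B : K) = σ (g : K) ^ p / σ e := by
      rw [eq_div_iff hσe, ← map_mul, mul_comm, ← hBK, map_pow]
    have h2 : (B : K) = (g : K) ^ p / e := by rw [eq_div_iff he0, mul_comm, ← hBK]
    rw [h1, hy]
    nth_rw 1 [h2]
    have hgp0 : ((g : K) ^ (μ : ZMod p).val) ^ p ≠ 0 := pow_ne_zero _ (pow_ne_zero _ hg0)
    rw [div_pow, div_pow, mul_pow, pow_right_comm (g : K) p]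
    field_simp

end Existence

end Cyclo

/-! ### The main theorem -/

theorem theoreml203272 {p : ℕ} [Fact p.Prime] (hp : p ≠ 2)
    {K : Type*} [Field K] [NumberField K] [IsCyclotomicExtension {p} ℚ K]
    {ζ : K} (hζ : IsPrimitiveRoot ζ p)
    {u : ℕ} (hu : IsPrimitiveRoot (u : ZMod p) (p - 1))
    (σ : K ≃ₐ[ℚ] K) (hσ : σ ζ = ζ ^ u)
    (b : (Ideal (𝓞 K))⁰) (hbπ : ¬ Cyclo.piIdeal hζ ∣ (b : Ideal (𝓞 K)))
    (hb : ClassGroup.mk0 b ∈ Cyclo.positiveClasses p ζ)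
    (μ : (ZMod p)ˣ) (hμ : Cyclo.AnnihilatedBy σ (μ : ZMod p) b) :
    (ClassGroup.mk0 b ≠ 1 →
      ∃ m : ℕ, 1 ≤ m ∧ m ≤ (p - 3) / 2 ∧ (μ : ZMod p).val = Cyclo.rootPow p u (2 * m)) ∧
    ∀ m : ℕ, 1 ≤ m → m ≤ (p - 3) / 2 → (μ : ZMod p).val = Cyclo.rootPow p u (2 * m) →
      (∃ B : 𝓞 K,
        Cyclo.IsSingularSemiPrimary hζ B ∧ Cyclo.IsSingularPositive p ζ B ∧
        Ideal.span {B} = (b : Ideal (𝓞 K)) ^ p ∧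
        ∃ α : K, σ (B : K) = (B : K) ^ (μ : ZMod p).val * α ^ p) ∧
      ∀ B : 𝓞 K,
        Cyclo.IsSingularSemiPrimary hζ B → Cyclo.IsSingularPositive p ζ B →
        Ideal.span {B} = (b : Ideal (𝓞 K)) ^ p →
        (∃ α : K, σ (B : K) = (B : K) ^ (μ : ZMod p).val * α ^ p) →
        ¬ Cyclo.IsSingularPrimary hζ B →
        Cyclo.PiExactlyDivides hζ (2 * m) (B ^ (p - 1) - 1) := by
  have hprime := (Fact.out : p.Prime)
  obtain ⟨s, hs⟩ : ∃ s, 2 * s = p - 1 := by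
    obtain ⟨k, hk⟩ := hprime.odd_of_ne_two hp
    exact ⟨k, by omega⟩
  have hs0 : 0 < s := by
    have := hprime.two_le
    omega
  refine ⟨fun hb1 ↦ ?_, fun m hm hmp hμm ↦ ?_⟩
  · obtain ⟨m, hm, hmp, h⟩ := Cyclo.exists_eq_even_pow hu hs hs0
      (Cyclo.eigenvalue_pow_half_eq_one hζ hu hσ hs hs0 hb hμ hb1)
      (Cyclo.eigenvalue_ne_one hζ hu hσ hb hμ hb1)
    exact ⟨m, hm, hmp, (Cyclo.val_eq_rootPow_iff _ _).mpr h⟩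
  · rw [Cyclo.val_eq_rootPow_iff] at hμm
    have hmlt : 2 * m < p - 1 := by omega
    refine ⟨?_, fun B hB _ hspan ⟨α, hα⟩ hprim ↦
      Cyclo.piExactlyDivides_of_not_primary hζ hu hσ hbπ hspan hm hmlt hμm hα hB.1 hprim⟩
    obtain ⟨B, hspan, hBpow, α, hα⟩ : ∃ B : 𝓞 K, Ideal.span {B} = (b : Ideal (𝓞 K)) ^ p ∧
        (¬ ∃ x : K, x ^ p = (B : K)) ∧
        ∃ α : K, σ (B : K) = (B : K) ^ (μ : ZMod p).val * α ^ p := by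
      -- In the principal case the class says nothing about `μ`; `μ ^ s = 1` and `μ ≠ 1` come from
      -- `μ = u ^ (2m)` with `0 < 2m < p - 1`.
      by_cases hb1 : ClassGroup.mk0 b = 1
      · obtain ⟨β, hβ⟩ := (ClassGroup.mk0_eq_one_iff b.2).mp hb1
        have hβ : (b : Ideal (𝓞 K)) = Ideal.span {β} := hβ
        have hβ0 : β ≠ 0 := by
          rintro rfl
          rw [Ideal.span_singleton_zero] at hβ
          exact mem_nonZeroDivisors_iff_ne_zero.mp b.2 hβ
        rw [hβ]
        refine Cyclo.exists_generator_of_isPrincipal hζ hu hσ hs hs0 ?_ ?_ hβ0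
        · rw [hμm, ← pow_mul, mul_right_comm, hs, pow_mul, hu.pow_eq_one, one_pow]
        · rw [hμm]
          exact hu.pow_ne_one_of_pos_of_lt (by omega) hmlt
      · exact Cyclo.exists_generator_of_not_isPrincipal hζ hu hσ
          (Cyclo.pow_eq_one_of_mem_positiveClasses hb) hb1 hμ
    have hsing : Cyclo.IsSingular p B := ⟨hBpow, b, hspan⟩
    exact ⟨B, ⟨hsing, Cyclo.exists_int_sub_mem_sq hζ hu hσ hbπ hspan hm hmlt hμm hα⟩,
      ⟨hsing, b, hspan, hb⟩, hspan, α, hα⟩
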